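/- Let $k$ be a field of characteristic zero. Let $\mathbb{Z}_{\rm fin}$ be the group of finite subsets of $\mathbb{Z}$ under symmetric difference $\oplus$, and let $$C = k[x_n \mid n\in\mathbb{Z}]/(x_n^2+n = x_m^2+m \ \text{ for all } m,n\in\mathbb{Z}),$$ graded by $\mathbb{Z}_{\rm fin}$ with $\deg x_n=\{n\}$. Let $\mathrm{Gr}(C,\mathbb{Z}_{\rm fin})$ be the $k$-linear category of $\mathbb{Z}_{\rm fin}$-graded $C$-modules and degree-preserving homomorphisms, and let $\mathrm{Pic}(C,\mathbb{Z}_{\rm fin})$ be the group of its $k$-linear autoequivalences modulo natural isomorphism, with $[F][G]=[F\circ G]$. For $J\in\mathbb{Z}_{\rm fin}$ let $(J)$ be the twist functor $M\mapsto M(J)$, where $M(J)=M$ as a $C$-module and $M(J)_I=M_{J\oplus I}$. For $n\in\mathbb{Z}$ put $X_n=C/(x_n)$ and $Y_n=(C/(x_n))(\{n\})$, and for $c\in k\setminus\mathbb{Z}$ put $\mathcal{O}_c=C/(x_0^2-c)$. Let $C_\phi$ be the degree $\phi=\emptyset$ component of $C$ and $z=x_0^2$. Let $\mathrm{Iso}(\mathbb{Z})$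 be the isometry group of $\mathbb{Z}$ with the metric $|m-n|$; its elements are the maps $n\mapsto \varepsilon n+d$ with $\varepsilon=\pm1$, $d\in\mathbb{Z}$. **Theorem.** There is an exact sequence of groups $$1\to \mathbb{Z}_{\rm fin}\to \mathrm{Pic}(C,\mathbb{Z}_{\rm fin})\to \mathrm{Iso}(\mathbb{Z})\to 1 .$$ The first map sends $J$ to $[(J)]$. The second map sends $[F]$ to the isometry $n\mapsto\varepsilon n+d$, where $\varepsilon\in\{\pm1\}$ and $d\in\mathbb{Z}$ are the unique values such that $$F X_n\oplus F Y_n\cong X_{\varepsilon n+d}\oplus Y_{\varepsilon n+d}\quad\text{for all } n\in\mathbb{Z};$$ moreover $F\mathcal{O}_c\cong\mathcal{O}_{\varepsilon c+d}$ for all $c\in k\setminus\mathbb{Z}$. Equivalently, the second map is given by the induced automorphism of $C_\phi$, as follows. The ring $C_\phi$ is the polynomial ring $k[z]$, and the map $\mu:C_\phi\to\mathrm{End}(\mathrm{id}_{\mathrm{Gr}(C,\mathbb{Z}_{\rm fin})})$, where $\mu_a$ is multiplication by $a$, is bijective. There is a group homomorphism $\alpha:\mathrm{Pic}(C,\mathbb{Z}_{\rm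 fin})\to\mathrm{Aut}_{k}(C_\phi)$, $[F]\mapsto\alpha_F$, into the group of $k$-algebra automorphisms, determined by $$(\mu_{\alpha_F(a)})_M=\eta_M^{-1}\circ F\big((\mu_a)_{GM}\big)\circ\eta_M\quad\text{for all } a\in C_\phi \text{ and all } M,$$ where $G$ is a quasi-inverse of $F$ that is left adjoint to $F$, with unit $\eta:\mathrm{id}\to FG$. The second map sends $[F]$ to $n\mapsto\varepsilon n+d$ if and only if $\alpha_F(z)=\varepsilon(z-d)$. -/

import Mathlib

open CategoryTheory CategoryTheory.Limits

universe u v w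

noncomputable section

/-! ## Internal direct sums -/

section Internal

/-- A criterion for a family of subgroups to be an internal direct sum decomposition,
in terms of projections to the components. -/
theorem isInternal_of_proj {ι : Type*} [DecidableEq ι] {M σ : Type*} [AddCommGroup M]
    [SetLike σ M] [AddSubmonoidClass σ M] (ℳ : ι → σ) (p : ι → M →+ M)
    (h1 : ∀ i x, x ∈ ℳ i → p i x = x)
    (h2 : ∀ i j x, x ∈ ℳ j → j ≠ i → p i x = 0)
    (h3 : ∀ x : M, x ∈ AddSubmonoid.closure (⋃ i, (ℳ i : Set M))) :
    DirectSum.IsInternal ℳ := by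
  have key : ∀ (x : DirectSum ι fun i => ℳ i) (i : ι),
      p i (DirectSum.coeAddMonoidHom ℳ x) = (x i : M) := by
    intro x i
    induction x using DirectSum.induction_on with
    | zero => simp
    | of j y =>
      rw [DirectSum.coeAddMonoidHom_of]
      by_cases hij : j = i
      · subst hij
        rw [h1 _ _ y.2, DirectSum.of_eq_same]
      · rw [h2 i j _ y.2 hij, DirectSum.of_eq_of_ne _ _ _ (fun h => hij h.symm)]
        rfl
    | add x y hx hy =>
      rw [map_add, map_add, hx, hy, DirectSum.add_apply]
      rfl
  constructor
  · intro x y hxy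
    ext i
    rw [← key x i, ← key y i, hxy]
  · intro x
    have := h3 x
    rw [← AddMonoidHom.mem_mrange]
    refine (AddSubmonoid.closure_le.mpr ?_) this
    intro y hy
    obtain ⟨i, hi⟩ := Set.mem_iUnion.mp hy
    exact ⟨DirectSum.of (fun i => ℳ i) i ⟨y, hi⟩, by simp⟩

/-- The projections to the components of an internal direct sum decomposition. -/
theorem exists_proj_of_isInternal {ι : Type*} [DecidableEq ι] {M σ : Type*} [AddCommGroup M]
    [SetLike σ M] [AddSubmonoidClass σ M] (ℳ : ι → σ) (h : DirectSum.IsInternal ℳ) :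
    ∃ p : ι → M →+ M,
      (∀ i x, x ∈ ℳ i → p i x = x) ∧
      (∀ i j x, x ∈ ℳ j → j ≠ i → p i x = 0) ∧
      (∀ x : M, x ∈ AddSubmonoid.closure (⋃ i, (ℳ i : Set M))) := by
  classical
  let : DirectSum.Decomposition ℳ := h.chooseDecomposition
  refine ⟨fun i => ((AddSubmonoidClass.subtype (ℳ i)).comp
    (DFinsupp.evalAddMonoidHom i)).comp
      (DirectSum.decomposeAddEquiv ℳ).toAddMonoidHom, ?_, ?_, ?_⟩
  · intro i x hx
    exact DirectSum.decompose_of_mem_same ℳ hx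
  · intro i j x hx hij
    exact DirectSum.decompose_of_mem_ne ℳ hx hij
  · intro x
    rw [← DirectSum.sum_support_decompose ℳ x]
    refine sum_mem fun i _ => AddSubmonoid.subset_closure ?_
    exact Set.mem_iUnion.mpr ⟨i, SetLike.coe_mem _⟩

/-- The image of an internal direct sum decomposition under a surjection whose kernel is
homogeneous. -/
theorem isInternal_of_surjective {ι : Type*} [DecidableEq ι] {M σ M' σ' : Type*} [AddCommGroup M]
    [SetLike σ M] [AddSubmonoidClass σ M] [AddCommGroup M'] [SetLike σ' M']
    [AddSubmonoidClass σ' M'] (ℳ : ι → σ) [DirectSum.Decomposition ℳ] (ℳ' : ι → σ')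
    (f : M →+ M') (hf : Function.Surjective f)
    (hmem : ∀ i y, y ∈ ℳ' i ↔ ∃ x ∈ ℳ i, f x = y)
    (hker : ∀ i x, f x = 0 → f (DirectSum.decompose ℳ x i : M) = 0) :
    DirectSum.IsInternal ℳ' := by
  classical
  let p : ι → M →+ M := fun i => ((AddSubmonoidClass.subtype (ℳ i)).comp
    (DFinsupp.evalAddMonoidHom i)).comp (DirectSum.decomposeAddEquiv ℳ).toAddMonoidHom
  have hp : ∀ i x, p i x = (DirectSum.decompose ℳ x i : M) := fun i x => rfl
  let q : ι → M' →+ M' := fun i => AddMonoidHom.liftOfRightInverse f (Function.surjInv hf)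
    (Function.rightInverse_surjInv hf) ⟨f.comp (p i), fun x hx => hker i x hx⟩
  have hq : ∀ i x, q i (f x) = f (p i x) := fun i x =>
    AddMonoidHom.liftOfRightInverse_comp_apply f _ (Function.rightInverse_surjInv hf)
      ⟨f.comp (p i), fun x hx => hker i x hx⟩ x
  refine isInternal_of_proj ℳ' q ?_ ?_ ?_
  · intro i y hy
    obtain ⟨x, hx, rfl⟩ := (hmem i y).1 hy
    rw [hq, hp, DirectSum.decompose_of_mem_same ℳ hx]
  · intro i j y hy hij
    obtain ⟨x, hx, rfl⟩ := (hmem j y).1 hy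
    rw [hq, hp, DirectSum.decompose_of_mem_ne ℳ hx hij, map_zero]
  · intro y
    obtain ⟨x, rfl⟩ := hf y
    rw [← DirectSum.sum_support_decompose ℳ x, map_sum]
    refine sum_mem fun i _ => AddSubmonoid.subset_closure ?_
    exact Set.mem_iUnion.mpr ⟨i, (hmem i _).2 ⟨_, SetLike.coe_mem _, rfl⟩⟩

end Internal

/-! ## The category of graded modules over a commutative graded algebra -/

section GradedModules

variable {k R : Type u} {Γ : Type w} [CommRing k] [CommRing R] [Algebra k R]
  [AddCommGroup Γ] [DecidableEq Γ]

/-- A `Γ`-graded module over the commutative algebra `R` graded by `𝒜`: an `R`-module `M` with a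
decomposition `M = ⨁ M_i` into subgroups such that `R_i M_j ⊆ M_{i+j}`. -/
structure GrMod (𝒜 : Γ → Submodule k R) where
  carrier : Type u
  [isAddCommGroup : AddCommGroup carrier]
  [isModule : Module R carrier]
  gr : Γ → AddSubgroup carrier
  isInternal : DirectSum.IsInternal gr
  smul_mem : ∀ {i j : Γ} {a : R} {m : carrier}, a ∈ 𝒜 i → m ∈ gr j → a • m ∈ gr (i + j)

namespace GrMod

attribute [instance] GrMod.isAddCommGroup GrMod.isModule

variable {𝒜 : Γ → Submodule k R}

/-- A degree-preserving `R`-linear map. -/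
@[ext]
structure Hom (M N : GrMod 𝒜) where
  toLin : M.carrier →ₗ[R] N.carrier
  map_mem : ∀ (i : Γ) (m : M.carrier), m ∈ M.gr i → toLin m ∈ N.gr i

instance : Category (GrMod 𝒜) where
  Hom M N := Hom M N
  id M := ⟨LinearMap.id, fun _ _ h => h⟩
  comp f g := ⟨g.toLin.comp f.toLin, fun i _ h => g.map_mem i _ (f.map_mem i _ h)⟩

@[ext]
theorem hom_ext {M N : GrMod 𝒜} {f g : M ⟶ N} (h : ∀ m, f.toLin m = g.toLin m) : f = g :=
  Hom.ext (LinearMap.ext h)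

@[simp] theorem id_toLin (M : GrMod 𝒜) : Hom.toLin (𝟙 M) = LinearMap.id := rfl

@[simp] theorem comp_toLin {M N P : GrMod 𝒜} (f : M ⟶ N) (g : N ⟶ P) :
    (f ≫ g).toLin = g.toLin.comp f.toLin := rfl

section HomGroup

variable (M N : GrMod 𝒜)

instance : Zero (M ⟶ N) := ⟨⟨0, fun i _ _ => (N.gr i).zero_mem⟩⟩

instance : Add (M ⟶ N) := ⟨fun f g => ⟨f.toLin + g.toLin, fun i m h =>
  (N.gr i).add_mem (f.map_mem i m h) (g.map_mem i m h)⟩⟩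

instance : Neg (M ⟶ N) := ⟨fun f => ⟨-f.toLin, fun i m h =>
  (N.gr i).neg_mem (f.map_mem i m h)⟩⟩

instance : Sub (M ⟶ N) := ⟨fun f g => ⟨f.toLin - g.toLin, fun i m h =>
  (N.gr i).sub_mem (f.map_mem i m h) (g.map_mem i m h)⟩⟩

instance : SMul ℕ (M ⟶ N) := ⟨fun n f => ⟨n • f.toLin, fun i m h =>
  (N.gr i).nsmul_mem (f.map_mem i m h) n⟩⟩

instance : SMul ℤ (M ⟶ N) := ⟨fun n f => ⟨n • f.toLin, fun i m h =>
  (N.gr i).zsmul_mem (f.map_mem i m h) n⟩⟩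

theorem toLin_injective : Function.Injective (fun f : M ⟶ N => f.toLin) :=
  fun _ _ h => Hom.ext h

instance : AddCommGroup (M ⟶ N) :=
  (toLin_injective M N).addCommGroup _ rfl (fun _ _ => rfl) (fun _ => rfl) (fun _ _ => rfl)
    (fun _ _ => rfl) (fun _ _ => rfl)

@[simp] theorem zero_toLin : Hom.toLin (0 : M ⟶ N) = 0 := rfl

variable {M N}

@[simp] theorem add_toLin (f g : M ⟶ N) : (f + g).toLin = f.toLin + g.toLin := rfl

end HomGroup

instance : Preadditive (GrMod 𝒜) where
  add_comp := by
    intros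
    ext m
    simp
  comp_add := by
    intros
    ext m
    simp

section LinearStructure

variable [SetLike.GradedMonoid 𝒜]

/-- A scalar of `k` acts on homomorphisms through its image in `R`. -/
instance (M N : GrMod 𝒜) : SMul k (M ⟶ N) := ⟨fun c f => ⟨algebraMap k R c • f.toLin, fun i m h => by
  have := N.smul_mem (SetLike.algebraMap_mem_graded 𝒜 c) (f.map_mem i m h)
  rwa [zero_add] at this⟩⟩

@[simp] theorem smul_toLin {M N : GrMod 𝒜} (c : k) (f : M ⟶ N) :
    (c • f).toLin = algebraMap k R c • f.toLin := rfl

instance (M N : GrMod 𝒜) : Module k (M ⟶ N) where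
  one_smul f := by ext m; simp
  mul_smul a b f := by ext m; simp [mul_smul]
  smul_zero a := by ext m; simp
  smul_add a f g := by ext m; simp
  add_smul a b f := by ext m; simp [add_smul]
  zero_smul f := by ext m; simp

instance : CategoryTheory.Linear k (GrMod 𝒜) where
  smul_comp := by
    intros
    ext m
    simp
  comp_smul := by
    intros
    ext m
    simp

end LinearStructure

/-- The direct sum of two graded modules, with `(M ⊕ N)_i = M_i ⊕ N_i`. -/
def prod (M N : GrMod 𝒜) : GrMod 𝒜 where
  carrier := M.carrier × N.carrier
  gr i := (M.gr i).prod (N.gr i)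
  isInternal := by
    obtain ⟨p, p1, p2, p3⟩ := exists_proj_of_isInternal _ M.isInternal
    obtain ⟨q, q1, q2, q3⟩ := exists_proj_of_isInternal _ N.isInternal
    refine isInternal_of_proj _ (fun i => (p i).prodMap (q i)) ?_ ?_ ?_
    · rintro i ⟨x, y⟩ ⟨hx, hy⟩
      exact Prod.ext (p1 i x hx) (q1 i y hy)
    · rintro i j ⟨x, y⟩ ⟨hx, hy⟩ hij
      exact Prod.ext (p2 i j x hx hij) (q2 i j y hy hij)
    · rintro ⟨x, y⟩
      have hx : ∀ x : M.carrier, ((x, 0) : M.carrier × N.carrier) ∈ AddSubmonoid.closure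
          (⋃ i, (((M.gr i).prod (N.gr i) : AddSubgroup _) : Set (M.carrier × N.carrier))) := by
        intro x
        have h : AddSubmonoid.closure (⋃ i, (M.gr i : Set M.carrier)) ≤
            (AddSubmonoid.closure (⋃ i, (((M.gr i).prod (N.gr i) : AddSubgroup _) :
              Set (M.carrier × N.carrier)))).comap (AddMonoidHom.inl _ _) := by
          refine AddSubmonoid.closure_le.mpr fun z hz => AddSubmonoid.subset_closure ?_
          obtain ⟨i, hi⟩ := Set.mem_iUnion.mp hz
          exact Set.mem_iUnion.mpr ⟨i, hi, (N.gr i).zero_mem⟩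
        exact h (p3 x)
      have hy : ∀ y : N.carrier, ((0, y) : M.carrier × N.carrier) ∈ AddSubmonoid.closure
          (⋃ i, (((M.gr i).prod (N.gr i) : AddSubgroup _) : Set (M.carrier × N.carrier))) := by
        intro y
        have h : AddSubmonoid.closure (⋃ i, (N.gr i : Set N.carrier)) ≤
            (AddSubmonoid.closure (⋃ i, (((M.gr i).prod (N.gr i) : AddSubgroup _) :
              Set (M.carrier × N.carrier)))).comap (AddMonoidHom.inr _ _) := by
          refine AddSubmonoid.closure_le.mpr fun z hz => AddSubmonoid.subset_closure ?_
          obtain ⟨i, hi⟩ := Set.mem_iUnion.mp hz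
          exact Set.mem_iUnion.mpr ⟨i, (M.gr i).zero_mem, hi⟩
        exact h (q3 y)
      have := add_mem (hx x) (hy y)
      simpa using this
  smul_mem ha hm := ⟨M.smul_mem ha hm.1, N.smul_mem ha hm.2⟩

/-- The biproduct data of `GrMod.prod`. -/
def prodBicone (M N : GrMod 𝒜) : BinaryBicone M N where
  pt := prod M N
  fst := ⟨LinearMap.fst R _ _, fun _ _ h => h.1⟩
  snd := ⟨LinearMap.snd R _ _, fun _ _ h => h.2⟩
  inl := ⟨LinearMap.inl R _ _, fun i _ h => ⟨h, (N.gr i).zero_mem⟩⟩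
  inr := ⟨LinearMap.inr R _ _, fun i _ h => ⟨(M.gr i).zero_mem, h⟩⟩

instance : HasBinaryBiproducts (GrMod 𝒜) where
  has_binary_biproduct M N := hasBinaryBiproduct_of_total (prodBicone M N) (by
    refine hom_ext fun (m : M.carrier × N.carrier) => ?_
    change (m.1, (0 : N.carrier)) + ((0 : M.carrier), m.2) = m
    simp)

/-- An isomorphism of graded modules from a linear equivalence preserving degrees. -/
def isoMk {M N : GrMod 𝒜} (e : M.carrier ≃ₗ[R] N.carrier)
    (h : ∀ i m, m ∈ M.gr i ↔ e m ∈ N.gr i) : M ≅ N where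
  hom := ⟨e.toLinearMap, fun i m hm => (h i m).1 hm⟩
  inv := ⟨e.symm.toLinearMap, fun i m hm => (h i _).2 (by simpa using hm)⟩
  hom_inv_id := by
    refine hom_ext fun m => ?_
    change e.symm (e m) = m
    simp
  inv_hom_id := by
    refine hom_ext fun m => ?_
    change e (e.symm m) = m
    simp

/-- The twist `M(J)`: the same module with `M(J)_i = M_{J+i}`. -/
def twistObj (J : Γ) (M : GrMod 𝒜) : GrMod 𝒜 where
  carrier := M.carrier
  gr i := M.gr (J + i)
  isInternal := by
    obtain ⟨p, p1, p2, p3⟩ := exists_proj_of_isInternal _ M.isInternal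
    refine isInternal_of_proj _ (fun i => p (J + i)) (fun i x => p1 (J + i) x)
      (fun i j x hx hij => p2 (J + i) (J + j) x hx (fun h => hij (add_left_cancel h))) ?_
    intro x
    refine AddSubmonoid.closure_mono ?_ (p3 x)
    intro y hy
    obtain ⟨i, hi⟩ := Set.mem_iUnion.mp hy
    refine Set.mem_iUnion.mpr ⟨i - J, ?_⟩
    simpa using hi
  smul_mem {i j a m} ha hm := by
    have := M.smul_mem ha hm
    rwa [add_left_comm] at this

/-- The twist functor `(J)`. -/
def twistFunctor (𝒜 : Γ → Submodule k R) (J : Γ) : GrMod 𝒜 ⥤ GrMod 𝒜 where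
  obj M := twistObj J M
  map f := ⟨f.toLin, fun i m h => f.map_mem (J + i) m h⟩

/-- The twist `(J)` as an autoequivalence, with quasi-inverse `(-J)`. -/
def twistEquiv (𝒜 : Γ → Submodule k R) (J : Γ) : GrMod 𝒜 ≌ GrMod 𝒜 :=
  CategoryTheory.Equivalence.mk (twistFunctor 𝒜 J) (twistFunctor 𝒜 (-J))
    (NatIso.ofComponents
      (fun M => isoMk (N := twistObj (-J) (twistObj J M)) (LinearEquiv.refl R M.carrier) (by
        intro i m
        change m ∈ M.gr i ↔ m ∈ M.gr (J + (-J + i))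
        rw [add_neg_cancel_left]))
      (fun _ => rfl))
    (NatIso.ofComponents
      (fun M => isoMk (M := twistObj J (twistObj (-J) M)) (LinearEquiv.refl R M.carrier) (by
        intro i m
        change m ∈ M.gr (-J + (J + i)) ↔ m ∈ M.gr i
        rw [neg_add_cancel_left]))
      (fun _ => rfl))

/-- The graded module `R / (a)` for a homogeneous element `a` of the graded ring `R`; its
component of degree `i` is the image of `R_i`. -/
def cyclic [GradedAlgebra 𝒜] (a : R) (ha : SetLike.IsHomogeneousElem 𝒜 a) : GrMod 𝒜 where
  carrier := R ⧸ Ideal.span {a}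
  gr i := (𝒜 i).toAddSubgroup.map (Ideal.Quotient.mk (Ideal.span {a})).toAddMonoidHom
  isInternal := by
    refine isInternal_of_surjective 𝒜 _ (Ideal.Quotient.mk (Ideal.span {a})).toAddMonoidHom
      Ideal.Quotient.mk_surjective (fun i y => Iff.rfl) ?_
    intro i x hx
    have hI : (Ideal.span {a}).IsHomogeneous 𝒜 := Ideal.homogeneous_span 𝒜 _ (by
      rintro _ rfl
      exact ha)
    exact Ideal.Quotient.eq_zero_iff_mem.2 (hI i (Ideal.Quotient.eq_zero_iff_mem.1 hx))
  smul_mem := by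
    rintro i j r _ hr ⟨m, hm, rfl⟩
    exact ⟨r * m, SetLike.mul_mem_graded hr hm, rfl⟩

section DegreeZero

variable (𝒜) [SetLike.GradedMonoid 𝒜]

/-- The natural endomorphism `μ_a` of the identity functor of the category of graded modules given
by multiplication by an element `a` of the degree zero component `R_0`. -/
def mu (a : SetLike.GradeZero.subalgebra 𝒜) : 𝟭 (GrMod 𝒜) ⟶ 𝟭 (GrMod 𝒜) where
  app M := ⟨LinearMap.lsmul R M.carrier (a : R), fun i m hm => by
    have := M.smul_mem a.2 hm
    rwa [zero_add] at this⟩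
  naturality M N f := by
    refine hom_ext fun m => ?_
    change (a : R) • f.toLin m = f.toLin ((a : R) • m)
    rw [map_smul]

end DegreeZero

end GrMod

end GradedModules

/-! ## The Picard group of a `k`-linear category -/

section Picard

variable (k : Type u) [CommRing k] (A : Type v) [Category.{w} A] [Preadditive A]
  [CategoryTheory.Linear k A]

/-- A `k`-linear autoequivalence of the `k`-linear category `A` (with a chosen quasi-inverse). -/
structure LinAutoEquiv where
  toEquiv : A ≌ A
  additive : toEquiv.functor.Additive
  linear : toEquiv.functor.Linear k

namespace LinAutoEquiv

variable {k A}

/-- The object `F M` for an autoequivalence `F`. -/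
abbrev obj (F : LinAutoEquiv k A) (M : A) : A := F.toEquiv.functor.obj M

variable (k A) in
/-- The identity functor. -/
def refl : LinAutoEquiv k A :=
  ⟨CategoryTheory.Equivalence.refl, inferInstanceAs (𝟭 A).Additive,
    inferInstanceAs ((𝟭 A).Linear k)⟩

/-- The composition `F ∘ G`, which first applies `G` and then `F`. -/
def comp (F G : LinAutoEquiv k A) : LinAutoEquiv k A where
  toEquiv := G.toEquiv.trans F.toEquiv
  additive := by
    have := F.additive
    have := G.additive
    exact inferInstanceAs (G.toEquiv.functor ⋙ F.toEquiv.functor).Additive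
  linear := by
    have := F.linear
    have := G.linear
    exact inferInstanceAs ((G.toEquiv.functor ⋙ F.toEquiv.functor).Linear k)

/-- The quasi-inverse of an autoequivalence. -/
def symm (F : LinAutoEquiv k A) : LinAutoEquiv k A where
  toEquiv := F.toEquiv.symm
  additive := by
    have := F.additive
    exact inferInstanceAs F.toEquiv.inverse.Additive
  linear := by
    have := F.linear
    exact inferInstanceAs (F.toEquiv.inverse.Linear k)

variable (k A) in
/-- Two autoequivalences are identified if their functors are naturally isomorphic. -/
def setoid : Setoid (LinAutoEquiv k A) where
  r F G := Nonempty (F.toEquiv.functor ≅ G.toEquiv.functor)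
  iseqv := ⟨fun _ => ⟨Iso.refl _⟩, fun ⟨e⟩ => ⟨e.symm⟩, fun ⟨e⟩ ⟨f⟩ => ⟨e.trans f⟩⟩

/-- The ring automorphism of `End(id_A)` induced by an autoequivalence `F` with left adjoint
quasi-inverse `G` and unit `η : id ≅ F G`: it sends `τ` to the natural transformation
with components `η_M⁻¹ ∘ F(τ_{GM}) ∘ η_M`. -/
def conj (F : LinAutoEquiv k A) (τ : 𝟭 A ⟶ 𝟭 A) : 𝟭 A ⟶ 𝟭 A where
  app M := F.toEquiv.counitInv.app M ≫
    F.toEquiv.functor.map (τ.app (F.toEquiv.inverse.obj M)) ≫ F.toEquiv.counit.app M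
  naturality M N f := by
    have h := τ.naturality (F.toEquiv.inverse.map f)
    have h' := congrArg F.toEquiv.functor.map h
    simp only [Functor.id_map, Functor.map_comp] at h'
    have h1 := F.toEquiv.counitInv.naturality f
    have h2 := F.toEquiv.counit.naturality f
    simp only [Functor.id_map, Functor.comp_map] at h1 h2
    simp only [Functor.id_map, Category.assoc]
    rw [← h2, reassoc_of% h1, reassoc_of% h']

end LinAutoEquiv

/-- The Picard group of the `k`-linear category `A`: the group of `k`-linear autoequivalences
modulo natural isomorphism. -/
def PicardGroup := Quotient (LinAutoEquiv.setoid k A)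

namespace PicardGroup

variable {k A}

/-- The class `[F]` of an autoequivalence `F`. -/
def mk (F : LinAutoEquiv k A) : PicardGroup k A := Quotient.mk (LinAutoEquiv.setoid k A) F

theorem sound {F G : LinAutoEquiv k A} (e : F.toEquiv.functor ≅ G.toEquiv.functor) :
    mk F = mk G := Quotient.sound ⟨e⟩

/-- The group structure with `[F][G] = [F ∘ G]`. -/
instance : Group (PicardGroup k A) where
  mul := Quotient.map₂ LinAutoEquiv.comp (by
    rintro F F' ⟨e⟩ G G' ⟨f⟩
    exact ⟨NatIso.hcomp f e⟩)
  one := mk (LinAutoEquiv.refl k A)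
  inv := Quotient.map LinAutoEquiv.symm (by
    rintro F F' ⟨e⟩
    exact ⟨Iso.isoInverseOfIsoFunctor e⟩)
  mul_assoc := by
    rintro ⟨F⟩ ⟨G⟩ ⟨H⟩
    exact sound (Functor.associator _ _ _).symm
  one_mul := by
    rintro ⟨F⟩
    exact sound (Functor.rightUnitor _)
  mul_one := by
    rintro ⟨F⟩
    exact sound (Functor.leftUnitor _)
  inv_mul_cancel := by
    rintro ⟨F⟩
    exact sound F.toEquiv.unitIso.symm

end PicardGroup

end Picard

/-! ## The graded ring `C` and its graded modules -/

section RingC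

/-- The group `ℤ_fin` of finite subsets of `ℤ` under symmetric difference. -/
abbrev ZFin : Type := AsBoolRing (Finset ℤ)

instance : DecidableEq ZFin := inferInstanceAs (DecidableEq (Finset ℤ))

/-- A finite set of integers as an element of `ℤ_fin`. -/
abbrev ZFin.of (J : Finset ℤ) : ZFin := toBoolRing J

variable (k : Type u) [Field k]

/-- The ideal generated by the elements `(x_n² + n) - (x_m² + m)`. -/
def relIdeal : Ideal (MvPolynomial ℤ k) :=
  Ideal.span {p | ∃ n m : ℤ, p = (MvPolynomial.X n ^ 2 + MvPolynomial.C (n : k)) -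
    (MvPolynomial.X m ^ 2 + MvPolynomial.C (m : k))}

/-- The ring `C = k[x_n | n ∈ ℤ] / (x_n² + n = x_m² + m)`. -/
abbrev RingC : Type u := MvPolynomial ℤ k ⧸ relIdeal k

namespace RingC

/-- The generators `x_n`. -/
def x (n : ℤ) : RingC k := Ideal.Quotient.mk (relIdeal k) (MvPolynomial.X n)

theorem x_sq_add (n m : ℤ) :
    x k n ^ 2 + algebraMap k (RingC k) n = x k m ^ 2 + algebraMap k (RingC k) m :=
  Ideal.Quotient.eq.2 (Ideal.subset_span ⟨n, m, rfl⟩)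

theorem zfin_add (I J : Finset ℤ) :
    ZFin.of I + ZFin.of J = ZFin.of ((I \ J) ∪ (J \ I)) := rfl

theorem zfin_zero : (0 : ZFin) = ZFin.of ∅ := rfl

/-- The degrees of the variables: `deg x_n = {n}`. -/
def wt (n : ℤ) : ZFin := ZFin.of {n}

theorem two_wt (n : ℤ) : wt n + wt n = 0 := by
  change toBoolRing (symmDiff ({n} : Finset ℤ) {n}) = toBoolRing ⊥
  rw [symmDiff_self]

/-- The `ℤ_fin`-grading of `C` with `deg x_n = {n}`: the component `C_I` is the image of the
polynomials all of whose monomials have degree `I`. -/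
def grading (I : ZFin) : Submodule k (RingC k) :=
  (MvPolynomial.weightedHomogeneousSubmodule k wt I).map
    (Ideal.Quotient.mkₐ k (relIdeal k)).toLinearMap

theorem x_mem (n : ℤ) : x k n ∈ grading k (ZFin.of {n}) :=
  ⟨_, MvPolynomial.isWeightedHomogeneous_X k wt n, rfl⟩

instance : SetLike.GradedMonoid (grading k) where
  one_mem := ⟨1, MvPolynomial.isWeightedHomogeneous_one k wt,
    map_one (Ideal.Quotient.mkₐ k (relIdeal k))⟩
  mul_mem := by
    rintro i j _ _ ⟨a, ha, rfl⟩ ⟨b, hb, rfl⟩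
    exact ⟨a * b, MvPolynomial.IsWeightedHomogeneous.mul ha hb,
      map_mul (Ideal.Quotient.mkₐ k (relIdeal k)) _ _⟩

theorem isInternal_grading : DirectSum.IsInternal (grading k) := by
  let : GradedAlgebra (MvPolynomial.weightedHomogeneousSubmodule k wt) :=
    MvPolynomial.weightedGradedAlgebra k wt
  have hI : (relIdeal k).IsHomogeneous (MvPolynomial.weightedHomogeneousSubmodule k wt) := by
    refine Ideal.homogeneous_span _ _ ?_
    rintro _ ⟨n, m, rfl⟩
    have h : ∀ n : ℤ, MvPolynomial.IsWeightedHomogeneous wt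
        (MvPolynomial.X n ^ 2 + MvPolynomial.C (n : k)) 0 := by
      intro n
      refine MvPolynomial.IsWeightedHomogeneous.add ?_ (MvPolynomial.isWeightedHomogeneous_C wt _)
      have := (MvPolynomial.isWeightedHomogeneous_X k wt n).mul
        (MvPolynomial.isWeightedHomogeneous_X k wt n)
      rwa [two_wt, ← sq] at this
    exact ⟨0, Submodule.sub_mem _ (h n) (h m)⟩
  refine isInternal_of_surjective (MvPolynomial.weightedHomogeneousSubmodule k wt) _
    (Ideal.Quotient.mk (relIdeal k)).toAddMonoidHom Ideal.Quotient.mk_surjective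
    (fun i y => Iff.rfl) ?_
  intro i p hp
  exact Ideal.Quotient.eq_zero_iff_mem.2 (hI i (Ideal.Quotient.eq_zero_iff_mem.1 hp))

instance : GradedAlgebra (grading k) where
  toDecomposition := (isInternal_grading k).chooseDecomposition

/-- The degree zero component `C_φ`, a `k`-subalgebra of `C`. -/
abbrev degZero : Subalgebra k (RingC k) := SetLike.GradeZero.subalgebra (grading k)

theorem x_zero_sq_mem : x k 0 ^ 2 ∈ grading k 0 := by
  have := SetLike.mul_mem_graded (x_mem k 0) (x_mem k 0)
  rw [← sq] at this
  convert this using 2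
  exact (two_wt 0).symm

/-- The element `z = x_0²` of `C_φ`. -/
def z : degZero k := ⟨x k 0 ^ 2, x_zero_sq_mem k⟩

/-- The category `Gr(C, ℤ_fin)`. -/
abbrev GrC : Type (u + 1) := GrMod (grading k)

/-- The special simple module `X_n = C/(x_n)`. -/
def modX (n : ℤ) : GrC k := GrMod.cyclic (x k n) ⟨_, x_mem k n⟩

/-- The special simple module `Y_n = (C/(x_n))({n})`. -/
def modY (n : ℤ) : GrC k := GrMod.twistObj (ZFin.of {n}) (modX k n)

/-- The module `𝒪_c = C/(x_0² - c)`. -/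
def modO (c : k) : GrC k := GrMod.cyclic (x k 0 ^ 2 - algebraMap k (RingC k) c)
  ⟨0, Submodule.sub_mem _ (x_zero_sq_mem k) (SetLike.algebraMap_mem_graded (grading k) c)⟩

/-- The group `Pic(C, ℤ_fin)`. -/
abbrev Pic : Type (u + 1) := PicardGroup k (GrC k)

/-- The `k`-linear autoequivalence `(J)`. -/
def twist (J : Finset ℤ) : LinAutoEquiv k (GrC k) where
  toEquiv := GrMod.twistEquiv (grading k) (ZFin.of J)
  additive := ⟨fun {_ _ _ _} => rfl⟩
  linear := ⟨fun _ _ => rfl⟩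

end RingC

end RingC

end

/-!
The Picard group acts on `C_φ`, because `C_φ` is the ring of endomorphisms of the identity functor:
an endomorphism is determined by its components on the free modules `C(I)` of rank one, where it
has to be multiplication by a polynomial in `z` (`RingC.mu_bijective`). The point of view
throughout is that `C_φ = k[z]` and that the component `C_I` is the free `k[z]`-module on `x_I =
∏_{i ∈ I} x_i`, whose square is `∏_{i ∈ I} (z - i)`.

*The isometry.* An automorphism of `k[z]` sends `z` to `a z + b`, so an autoequivalence `F` moves
modules on which `z` acts by a scalar `c` to modules on which `z` acts by `(c - b) / a`. There is
one simple module at a point `c ∉ ℤ`, namely `𝒪_c`, and there are two at an integral point `n`,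
namely `X_n` and `Y_n` (`RingC.nonempty_modO_iso`, `RingC.nonempty_modX_or_modY_iso`). Hence `F`
preserves the set of integral points, and so does its inverse, which forces `a = ±1` and `b`
integral (`RingC.exists_alphaFun_z_eq`). The effect of `F` on simple modules follows.

*The kernel.* If `F` acts trivially on `C_φ`, it is `k[z]`-linear. The objects `F C(I)` then
satisfy the assumptions of `RingC.exists_iso_of_span_traceSet_eq_top`: they generate `C(J)`, and
the ideal of all composites `C(J) ⟶ F C(I) ⟶ C(J)` is the unit ideal of `k[z]`. A composite of
least degree turns out to be invertible, so that `F` permutes the modules `C(I)` up to isomorphism.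
After composition with a twist, `F` fixes `C`, and comparing the polynomials `x_I²` shows that it
fixes all `C(I)` compatibly with all homomorphisms. Since `M_I = Hom(C(I), M)`, it is isomorphic to
the identity (`RingC.nonempty_iso_id`, `RingC.exists_twist_of_alpha_eq_one`).

*Surjectivity.* For an affine permutation `s n = ε n + s 0` let `x_n` act on a graded module as
`x_{s n}` does, and relabel the degrees accordingly. If `ε = -1`, the relations require the square
of the new operator to be `-x_{s n}²`. This is achieved without a square root of `-1`: the operator
changes its sign on the components whose degree contains `s n` (`RingC.signedX`). The resulting
autoequivalence `RingC.regrade` induces the isometry inverse to `s`.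
-/

noncomputable section

/-! ### The action of autoequivalences on endomorphisms of the identity functor -/

section Conj

variable {k : Type u} [CommRing k] {A : Type v} [Category.{w} A] [Preadditive A]
  [CategoryTheory.Linear k A]

namespace LinAutoEquiv

theorem conj_app_obj (F : LinAutoEquiv k A) (τ : 𝟭 A ⟶ 𝟭 A) (N : A) :
    (F.conj τ).app (F.obj N) = F.toEquiv.functor.map (τ.app N) := by
  have h := τ.naturality (F.toEquiv.unit.app N)
  simp only [Functor.id_map, Functor.id_obj] at h
  change F.toEquiv.counitInv.app (F.toEquiv.functor.obj N) ≫
    F.toEquiv.functor.map (τ.app (F.toEquiv.inverse.obj (F.toEquiv.functor.obj N))) ≫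
      F.toEquiv.counit.app (F.toEquiv.functor.obj N) = _
  rw [Equivalence.counitInv_app_functor, Equivalence.counit_app_functor, ← Functor.map_comp,
    ← Functor.map_comp]
  congr 1
  have h' := reassoc_of% h
  refine (h' _).trans ?_
  simp

/-- Endomorphisms of the identity functor are determined on the image of an equivalence. -/
theorem natTrans_ext_obj (F : LinAutoEquiv k A) {τ τ' : 𝟭 A ⟶ 𝟭 A}
    (h : ∀ N, τ.app (F.obj N) = τ'.app (F.obj N)) : τ = τ' := by
  ext M
  have e := F.toEquiv.counitIso.app M
  have h1 := τ.naturality e.hom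
  have h2 := τ'.naturality e.hom
  have h3 := h (F.toEquiv.inverse.obj M)
  simp only [Functor.id_map] at h1 h2
  rw [← cancel_epi e.hom]
  refine h1.trans (Eq.trans ?_ h2.symm)
  exact congrArg (· ≫ e.hom) h3

/-- `F.conj τ` is the only endomorphism of the identity functor whose component at `F N` is
`F (τ_N)`, for all `N`. -/
theorem conj_eq_of_app (F : LinAutoEquiv k A) {τ τ' : 𝟭 A ⟶ 𝟭 A}
    (h : ∀ N, F.toEquiv.functor.map (τ.app N) = τ'.app (F.obj N)) : F.conj τ = τ' :=
  F.natTrans_ext_obj fun N => (F.conj_app_obj τ N).trans (h N)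

/-- Isomorphic autoequivalences act in the same way on the endomorphisms of the identity functor. -/
theorem conj_eq_of_iso {F G : LinAutoEquiv k A} (e : F.toEquiv.functor ≅ G.toEquiv.functor)
    (τ : 𝟭 A ⟶ 𝟭 A) : F.conj τ = G.conj τ := by
  refine F.conj_eq_of_app fun N => ?_
  have h1 := e.hom.naturality (τ.app N)
  have h2 := (G.conj τ).naturality (e.hom.app N)
  have h3 := G.conj_app_obj τ N
  rw [← cancel_mono (e.hom.app N)]
  refine h1.trans (Eq.trans ?_ h2)
  exact congrArg (e.hom.app N ≫ ·) h3.symm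

theorem conj_comp (F G : LinAutoEquiv k A) (τ : 𝟭 A ⟶ 𝟭 A) :
    (F.comp G).conj τ = F.conj (G.conj τ) := by
  refine (F.comp G).conj_eq_of_app fun N => ?_
  change F.toEquiv.functor.map (G.toEquiv.functor.map (τ.app N)) =
    (F.conj (G.conj τ)).app (F.obj (G.obj N))
  rw [conj_app_obj, conj_app_obj]

theorem conj_refl (τ : 𝟭 A ⟶ 𝟭 A) : (LinAutoEquiv.refl k A).conj τ = τ :=
  (LinAutoEquiv.refl k A).conj_eq_of_app fun _ => rfl

theorem conj_symm_conj (F : LinAutoEquiv k A) (τ : 𝟭 A ⟶ 𝟭 A) : F.symm.conj (F.conj τ) = τ := by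
  rw [← conj_comp]
  refine Eq.trans ?_ (conj_refl (k := k) τ)
  exact conj_eq_of_iso (F := F.symm.comp F) (G := LinAutoEquiv.refl k A) F.toEquiv.unitIso.symm _

theorem conj_conj_symm (F : LinAutoEquiv k A) (τ : 𝟭 A ⟶ 𝟭 A) : F.conj (F.symm.conj τ) = τ :=
  F.symm.conj_symm_conj τ

end LinAutoEquiv

end Conj

/-! ### Graded modules over a graded algebra -/

namespace GrMod

variable {k R : Type u} {Γ : Type w} [CommRing k] [CommRing R] [Algebra k R]
  [AddCommGroup Γ] [DecidableEq Γ] {𝒜 : Γ → Submodule k R}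

/-- A graded module is generated by its homogeneous elements. -/
theorem closure_gr (M : GrMod 𝒜) :
    AddSubmonoid.closure (⋃ i, (M.gr i : Set M.carrier)) = ⊤ := by
  obtain ⟨p, -, -, h⟩ := exists_proj_of_isInternal _ M.isInternal
  exact eq_top_iff.2 fun x _ => h x

/-- Additive maps out of a graded module are determined on homogeneous elements. -/
theorem addHom_ext {M : GrMod 𝒜} {B : Type*} [AddCommGroup B] {f g : M.carrier →+ B}
    (h : ∀ i, ∀ m ∈ M.gr i, f m = g m) : f = g := by
  refine AddMonoidHom.eq_of_eqOn_denseM (closure_gr M) fun x hx => ?_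
  obtain ⟨i, hi⟩ := Set.mem_iUnion.mp hx
  exact h i x hi

theorem hom_ext_homogeneous {M N : GrMod 𝒜} {f g : M ⟶ N}
    (h : ∀ i, ∀ m ∈ M.gr i, f.toLin m = g.toLin m) : f = g := by
  have : f.toLin.toAddMonoidHom = g.toLin.toAddMonoidHom := addHom_ext h
  exact hom_ext fun m => DFunLike.congr_fun this m

theorem exists_ne_zero_of_hom {M N : GrMod 𝒜} {f : M ⟶ N} (hf : f ≠ 0) :
    ∃ i, ∃ x ∈ M.gr i, f.toLin x ≠ 0 := by
  by_contra! h
  exact hf (hom_ext_homogeneous h)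

/-- The projection of a graded module to its component of degree `i`. -/
def proj (M : GrMod 𝒜) (i : Γ) : M.carrier →+ M.carrier :=
  let _ : DirectSum.Decomposition M.gr := M.isInternal.chooseDecomposition
  ((AddSubmonoidClass.subtype (M.gr i)).comp (DFinsupp.evalAddMonoidHom i)).comp
    (DirectSum.decomposeAddEquiv M.gr).toAddMonoidHom

theorem proj_mem (M : GrMod 𝒜) (i : Γ) (m : M.carrier) : M.proj i m ∈ M.gr i :=
  SetLike.coe_mem _

theorem proj_of_mem {M : GrMod 𝒜} {i : Γ} {m : M.carrier} (hm : m ∈ M.gr i) : M.proj i m = m :=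
  let _ : DirectSum.Decomposition M.gr := M.isInternal.chooseDecomposition
  DirectSum.decompose_of_mem_same M.gr hm

theorem proj_of_mem_ne {M : GrMod 𝒜} {i j : Γ} {m : M.carrier} (hm : m ∈ M.gr j) (h : j ≠ i) :
    M.proj i m = 0 :=
  let _ : DirectSum.Decomposition M.gr := M.isInternal.chooseDecomposition
  DirectSum.decompose_of_mem_ne M.gr hm h

theorem eq_zero_of_proj {M : GrMod 𝒜} {m : M.carrier} (hm : ∀ i, M.proj i m = 0) : m = 0 := by
  classical
  let _ : DirectSum.Decomposition M.gr := M.isInternal.chooseDecomposition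
  rw [← DirectSum.sum_support_decompose M.gr m]
  exact Finset.sum_eq_zero fun i _ => hm i

theorem proj_map {M N : GrMod 𝒜} (f : M ⟶ N) (i : Γ) (m : M.carrier) :
    N.proj i (f.toLin m) = f.toLin (M.proj i m) := by
  have : (N.proj i).comp f.toLin.toAddMonoidHom = f.toLin.toAddMonoidHom.comp (M.proj i) := by
    refine addHom_ext fun j m hm => ?_
    change N.proj i (f.toLin m) = f.toLin (M.proj i m)
    by_cases hij : j = i
    · subst hij
      rw [proj_of_mem hm, proj_of_mem (f.map_mem _ _ hm)]
    · rw [proj_of_mem_ne hm hij, proj_of_mem_ne (f.map_mem _ _ hm) hij, map_zero]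
  exact DFunLike.congr_fun this m

/-- A degree-preserving map which is injective on each component is injective. -/
theorem injective_of_homogeneous {M N : GrMod 𝒜} (f : M ⟶ N)
    (h : ∀ i, ∀ m ∈ M.gr i, f.toLin m = 0 → m = 0) : Function.Injective f.toLin := by
  rw [injective_iff_map_eq_zero]
  intro m hm
  refine eq_zero_of_proj fun i => h i _ (M.proj_mem i m) ?_
  rw [← proj_map, hm, map_zero]

/-- A degree-preserving map which is surjective on each component is surjective. -/
theorem surjective_of_homogeneous {M N : GrMod 𝒜} (f : M ⟶ N)
    (h : ∀ i, ∀ n ∈ N.gr i, ∃ m, f.toLin m = n) : Function.Surjective f.toLin := by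
  have : AddSubmonoid.closure (⋃ i, (N.gr i : Set N.carrier)) ≤
      AddMonoidHom.mrange f.toLin.toAddMonoidHom := by
    refine AddSubmonoid.closure_le.2 fun n hn => ?_
    obtain ⟨i, hi⟩ := Set.mem_iUnion.mp hn
    exact h i n hi
  rw [closure_gr] at this
  exact fun n => this (AddSubmonoid.mem_top n)

/-- A bijective degree-preserving map is an isomorphism. -/
theorem isIso_of_bijective {M N : GrMod 𝒜} (f : M ⟶ N) (hf : Function.Bijective f.toLin) :
    IsIso f := by
  have h : ∀ i m, m ∈ M.gr i ↔ LinearEquiv.ofBijective f.toLin hf m ∈ N.gr i := by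
    intro i m
    refine ⟨f.map_mem i m, fun h => ?_⟩
    rw [← hf.1 ((proj_map f i m).symm.trans (proj_of_mem h))]
    exact M.proj_mem i m
  exact (isoMk (LinearEquiv.ofBijective f.toLin hf) h).isIso_hom

theorem mono_of_injective {M N : GrMod 𝒜} (f : M ⟶ N) (hf : Function.Injective f.toLin) :
    Mono f where
  right_cancellation _ _ e := hom_ext fun m =>
    hf (congrArg (fun t : _ ⟶ N => t.toLin m) e)

/-- The additive map out of a graded module with given restrictions to the components. -/
def ofComponents {M : GrMod 𝒜} {B : Type*} [AddCommGroup B] (φ : ∀ i, M.gr i →+ B) :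
    M.carrier →+ B :=
  (DirectSum.toAddMonoid φ).comp
    (AddEquiv.ofBijective (DirectSum.coeAddMonoidHom M.gr) M.isInternal).symm.toAddMonoidHom

theorem ofComponents_apply {M : GrMod 𝒜} {B : Type*} [AddCommGroup B] (φ : ∀ i, M.gr i →+ B)
    {i : Γ} {m : M.carrier} (hm : m ∈ M.gr i) : ofComponents φ m = φ i ⟨m, hm⟩ := by
  let c := AddEquiv.ofBijective (DirectSum.coeAddMonoidHom M.gr) M.isInternal
  have : c (DirectSum.of (fun i => M.gr i) i ⟨m, hm⟩) = m := DirectSum.coeAddMonoidHom_of _ _ _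
  change DirectSum.toAddMonoid φ (c.symm m) = _
  conv_lhs => rw [← this, c.symm_apply_apply]
  exact DirectSum.toAddMonoid_of _ _ _

section FreeModules

variable [GradedAlgebra 𝒜]

variable (𝒜) in
/-- The graded ring as a graded module over itself. -/
def self : GrMod 𝒜 where
  carrier := R
  gr i := (𝒜 i).toAddSubgroup
  isInternal := isInternal_of_surjective 𝒜 _ (AddMonoidHom.id R) Function.surjective_id
    (fun i y => ⟨fun h => ⟨y, h, rfl⟩, by rintro ⟨x, hx, rfl⟩; exact hx⟩)
    (fun i x (hx : x = 0) => by
      subst hx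
      simp)
  smul_mem ha hm := SetLike.mul_mem_graded ha hm

variable (𝒜) in
/-- The free graded module with one generator, the element `1`, in degree `J`. -/
def free (J : Γ) : GrMod 𝒜 := twistObj (-J) (self 𝒜)

theorem one_mem_free (J : Γ) : (1 : R) ∈ (free 𝒜 J).gr J := by
  change (1 : R) ∈ 𝒜 (-J + J)
  rw [neg_add_cancel]
  exact SetLike.one_mem_graded 𝒜

/-- The value at the generator of a homomorphism from a free graded module. -/
def gen {J : Γ} {M : GrMod 𝒜} (f : free 𝒜 J ⟶ M) : M.carrier := f.toLin (1 : R)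

theorem gen_mem {J : Γ} {M : GrMod 𝒜} (f : free 𝒜 J ⟶ M) : gen f ∈ M.gr J :=
  f.map_mem J _ (one_mem_free (𝒜 := 𝒜) J)

/-- The homomorphism from a free graded module which sends the generator to `m`. -/
def desc {J : Γ} {M : GrMod 𝒜} (m : M.carrier) (hm : m ∈ M.gr J) : free 𝒜 J ⟶ M where
  toLin := LinearMap.toSpanSingleton R M.carrier m
  map_mem i r hr := by
    have := M.smul_mem (i := -J + i) (show (r : R) ∈ 𝒜 (-J + i) from hr) hm
    rwa [neg_add_cancel_comm] at this

@[simp] theorem gen_desc {J : Γ} {M : GrMod 𝒜} (m : M.carrier) (hm : m ∈ M.gr J) :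
    gen (desc m hm) = m := one_smul R m

theorem toLin_eq_smul_gen {J : Γ} {M : GrMod 𝒜} (f : free 𝒜 J ⟶ M) (r : R) :
    f.toLin r = r • gen f := by
  exact (congrArg f.toLin (mul_one r).symm).trans (f.toLin.map_smul r _)

theorem free_hom_ext {J : Γ} {M : GrMod 𝒜} {f g : free 𝒜 J ⟶ M} (h : gen f = gen g) : f = g :=
  hom_ext fun (r : R) => by rw [toLin_eq_smul_gen, toLin_eq_smul_gen, h]

@[simp] theorem gen_comp {J : Γ} {M N : GrMod 𝒜} (f : free 𝒜 J ⟶ M) (g : M ⟶ N) :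
    gen (f ≫ g) = g.toLin (gen f) := rfl

@[simp] theorem gen_zero {J : Γ} {M : GrMod 𝒜} : gen (0 : free 𝒜 J ⟶ M) = 0 := rfl

/-- The free graded modules generate the category of graded modules. -/
theorem exists_free_comp_ne_zero {M N : GrMod 𝒜} {f : M ⟶ N} (hf : f ≠ 0) :
    ∃ (J : Γ) (g : free 𝒜 J ⟶ M), g ≫ f ≠ 0 := by
  obtain ⟨J, x, hx, h⟩ := exists_ne_zero_of_hom hf
  refine ⟨J, desc x hx, fun h0 => h ?_⟩
  have := congrArg gen h0
  simpa using this

theorem injective_of_mono {M N : GrMod 𝒜} (f : M ⟶ N) [Mono f] : Function.Injective f.toLin := by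
  refine injective_of_homogeneous f fun i m hm h => ?_
  have : desc m hm = 0 := by
    rw [← cancel_mono f, zero_comp]
    refine free_hom_ext ?_
    simpa using h
  simpa using congrArg gen this

/-- A family of additive maps between the components of two graded modules which is compatible
with the action of homogeneous elements is a homomorphism of graded modules. -/
theorem exists_hom_of_components {M N : GrMod 𝒜} (φ : ∀ i, M.gr i →+ N.gr i)
    (h : ∀ {i j : Γ} {a : R} (ha : a ∈ 𝒜 i) (m : M.gr j),
      (φ (i + j) ⟨a • m, M.smul_mem ha m.2⟩ : N.carrier) = a • (φ j m : N.carrier)) :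
    ∃ f : M ⟶ N, ∀ i (m : M.gr i), f.toLin m = φ i m := by
  let g : M.carrier →+ N.carrier := ofComponents fun i => (N.gr i).subtype.comp (φ i)
  have hg : ∀ i (m : M.gr i), g m = φ i m := fun i m => ofComponents_apply _ m.2
  have hlin : ∀ (a : R) (m : M.carrier), g (a • m) = a • g m := by
    intro a m
    have h1 : ∀ i, ∀ a ∈ 𝒜 i, g.comp (DistribSMul.toAddMonoidHom M.carrier a) =
        (DistribSMul.toAddMonoidHom N.carrier a).comp g := by
      intro i a ha
      refine addHom_ext fun j m hm => ?_
      change g (a • m) = a • g m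
      rw [hg j ⟨m, hm⟩, ← h ha ⟨m, hm⟩]
      exact hg _ ⟨a • m, M.smul_mem ha hm⟩
    have h2 : g.comp ((AddMonoidHom.flip (smulAddHom R M.carrier)) m) =
        (AddMonoidHom.flip (smulAddHom R N.carrier)) (g m) :=
      addHom_ext (M := self 𝒜) fun i a ha => DFunLike.congr_fun (h1 i a ha) m
    exact DFunLike.congr_fun h2 a
  refine ⟨⟨{ g with map_smul' := hlin }, fun i m hm => ?_⟩, hg⟩
  change g m ∈ N.gr i
  rw [hg i ⟨m, hm⟩]
  exact (φ i ⟨m, hm⟩).2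

/-- The graded module `R / L` for a homogeneous ideal `L` of the graded ring `R`. -/
def quot (L : Ideal R) (hL : L.IsHomogeneous 𝒜) : GrMod 𝒜 where
  carrier := R ⧸ L
  gr i := (𝒜 i).toAddSubgroup.map (Ideal.Quotient.mk L).toAddMonoidHom
  isInternal := isInternal_of_surjective 𝒜 _ (Ideal.Quotient.mk L).toAddMonoidHom
    Ideal.Quotient.mk_surjective (fun _ _ => Iff.rfl) fun i _ hx =>
      Ideal.Quotient.eq_zero_iff_mem.2 (hL i (Ideal.Quotient.eq_zero_iff_mem.1 hx))
  smul_mem := by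
    rintro i j r _ hr ⟨m, hm, rfl⟩
    exact ⟨r * m, SetLike.mul_mem_graded hr hm, rfl⟩

/-- A set of homogeneous elements generates the unit ideal as soon as no nonzero homomorphism out
of a free module of rank one kills it. -/
theorem span_eq_top_of_forall_hom (J : Γ) (S : Set R)
    (hS : ∀ s ∈ S, SetLike.IsHomogeneousElem 𝒜 s)
    (h : ∀ (N : GrMod 𝒜) (f : free 𝒜 J ⟶ N), (∀ s ∈ S, f.toLin s = 0) → f = 0) :
    Ideal.span S = ⊤ := by
  have hL := Ideal.homogeneous_span 𝒜 S hS
  let f : free 𝒜 J ⟶ twistObj (-J) (quot (Ideal.span S) hL) :=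
    ⟨(Ideal.span S).mkQ, fun i m hm => ⟨m, hm, rfl⟩⟩
  have h0 : f = 0 := h _ f fun s hs => Ideal.Quotient.eq_zero_iff_mem.2 (Ideal.subset_span hs)
  have h1 : f.toLin (1 : R) = 0 := by
    rw [h0]
    rfl
  rw [Ideal.eq_top_iff_one]
  exact Ideal.Quotient.eq_zero_iff_mem.1 h1

end FreeModules

end GrMod

/-! ### The structure of the graded ring `C` -/

namespace RingC

open Polynomial in
/-- The polynomial `∏_{i ∈ I} (z - i)`, the square of `x_I`. -/
def rootPoly (k : Type u) [Field k] (I : Finset ℤ) : k[X] := ∏ i ∈ I, (X - C (i : k))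

variable (k : Type u) [Field k]

theorem rootPoly_ne_zero (I : Finset ℤ) : rootPoly k I ≠ 0 :=
  (Polynomial.monic_prod_of_monic _ _ fun _ _ => Polynomial.monic_X_sub_C _).ne_zero

/-- The homomorphism `k[z] → C` with `z ↦ x_0²`. -/
def ofPoly : Polynomial k →ₐ[k] RingC k := Polynomial.aeval (x k 0 ^ 2)

/-- The product `x_I = ∏_{i ∈ I} x_i`, which generates `C_I` as a `k[z]`-module. -/
def xp (I : ZFin) : RingC k := ∏ i ∈ ofBoolRing I, x k i

/-- The defining relations in terms of `z`: the square of `x_n` is `z - n`. -/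
theorem x_sq (n : ℤ) : x k n ^ 2 = ofPoly k (Polynomial.X - Polynomial.C (n : k)) := by
  have := x_sq_add k n 0
  rw [Int.cast_zero, map_zero, add_zero] at this
  simp only [ofPoly, map_sub, Polynomial.aeval_X, Polynomial.aeval_C]
  rw [← this, add_sub_cancel_right]

theorem xp_zero : xp k 0 = 1 := Finset.prod_empty

theorem xp_wt (n : ℤ) : xp k (wt n) = x k n := Finset.prod_singleton _ _

theorem xp_mul_xp (I J : ZFin) :
    xp k I * xp k J = ofPoly k (rootPoly k (ofBoolRing I ∩ ofBoolRing J)) * xp k (I + J) := by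
  have h1 : ofBoolRing (I + J) = symmDiff (ofBoolRing I) (ofBoolRing J) := rfl
  have h2 : ofBoolRing I ∪ ofBoolRing J =
      symmDiff (ofBoolRing I) (ofBoolRing J) ∪ (ofBoolRing I ∩ ofBoolRing J) :=
    (symmDiff_sup_inf (ofBoolRing I) (ofBoolRing J)).symm
  have h3 : Disjoint (symmDiff (ofBoolRing I) (ofBoolRing J)) (ofBoolRing I ∩ ofBoolRing J) :=
    disjoint_symmDiff_inf (ofBoolRing I) (ofBoolRing J)
  rw [xp, xp, ← Finset.prod_union_inter, h2, Finset.prod_union h3, xp, h1, rootPoly, map_prod]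
  simp only [← x_sq, Finset.prod_pow]
  ring

theorem add_self (I : ZFin) : I + I = 0 := by
  change toBoolRing (symmDiff (ofBoolRing I) (ofBoolRing I)) = toBoolRing ⊥
  rw [symmDiff_self]

theorem neg_eq (I : ZFin) : -I = I := neg_eq_of_add_eq_zero_left (add_self I)

theorem xp_sq (I : ZFin) : xp k I * xp k I = ofPoly k (rootPoly k (ofBoolRing I)) := by
  rw [xp_mul_xp, add_self, xp_zero, mul_one, Finset.inter_self]

theorem ofPoly_mem (p : Polynomial k) : ofPoly k p ∈ grading k 0 := by
  have : ofPoly k p = (Polynomial.aeval (z k) p : degZero k) := by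
    rw [Polynomial.aeval_subalgebra_coe]
    rfl
  rw [this]
  exact (Polynomial.aeval (z k) p).2

theorem xp_mem (I : ZFin) : xp k I ∈ grading k I := by
  have h : ∀ s : Finset ℤ, ∏ i ∈ s, x k i ∈ grading k (ZFin.of s) := by
    intro s
    induction s using Finset.induction_on with
    | empty => exact SetLike.one_mem_graded (grading k)
    | insert a s ha ih =>
      rw [Finset.prod_insert ha]
      have h1 : ZFin.of (insert a s) = ZFin.of {a} + ZFin.of s := by
        change toBoolRing (insert a s) = toBoolRing (symmDiff {a} s)
        rw [Disjoint.symmDiff_eq_sup (Finset.disjoint_singleton_left.2 ha)]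
        rfl
      rw [h1]
      exact SetLike.mul_mem_graded (x_mem k a) ih
  exact h _

variable {k} in
/-- The component `C_I` is generated by `x_I` as a `k[z]`-module. -/
theorem exists_ofPoly_mul_xp {I : ZFin} {c : RingC k} (hc : c ∈ grading k I) :
    ∃ p : Polynomial k, c = ofPoly k p * xp k I := by
  have h1 : ∀ e : ℤ →₀ ℕ, ∃ p : Polynomial k,
      Ideal.Quotient.mk (relIdeal k) (MvPolynomial.monomial e 1) =
        ofPoly k p * xp k (Finsupp.weight wt e) := by
    intro e
    have hadd : ∀ f g : ℤ →₀ ℕ,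
        (∃ p : Polynomial k, Ideal.Quotient.mk (relIdeal k) (MvPolynomial.monomial f 1) =
          ofPoly k p * xp k (Finsupp.weight wt f)) →
        (∃ p : Polynomial k, Ideal.Quotient.mk (relIdeal k) (MvPolynomial.monomial g 1) =
          ofPoly k p * xp k (Finsupp.weight wt g)) →
        ∃ p : Polynomial k, Ideal.Quotient.mk (relIdeal k) (MvPolynomial.monomial (f + g) 1) =
          ofPoly k p * xp k (Finsupp.weight wt (f + g)) := by
      rintro f g ⟨p, hp⟩ ⟨q, hq⟩
      have : (MvPolynomial.monomial (f + g) 1 : MvPolynomial ℤ k) =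
          MvPolynomial.monomial f 1 * MvPolynomial.monomial g 1 := by
        rw [MvPolynomial.monomial_mul, one_mul]
      refine ⟨p * q * rootPoly k (ofBoolRing (Finsupp.weight wt f) ∩
        ofBoolRing (Finsupp.weight wt g)), ?_⟩
      rw [this, map_mul, hp, hq, map_add, map_mul, map_mul, mul_assoc (ofPoly k p * ofPoly k q),
        ← xp_mul_xp]
      ring
    have hzero : ∃ p : Polynomial k, Ideal.Quotient.mk (relIdeal k)
        (MvPolynomial.monomial (0 : ℤ →₀ ℕ) 1) =
          ofPoly k p * xp k (Finsupp.weight wt (0 : ℤ →₀ ℕ)) := by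
      refine ⟨1, ?_⟩
      rw [map_zero (Finsupp.weight wt), xp_zero, map_one (ofPoly k), mul_one]
      exact map_one (Ideal.Quotient.mk (relIdeal k))
    induction e using Finsupp.induction_linear with
    | zero => exact hzero
    | add f g hf hg => exact hadd f g hf hg
    | single n m =>
      induction m with
      | zero =>
        rw [Finsupp.single_zero]
        exact hzero
      | succ m ih =>
        rw [Finsupp.single_add]
        refine hadd _ _ ih ⟨1, ?_⟩
        rw [Finsupp.weight_single, one_smul, xp_wt, map_one (ofPoly k), one_mul]
        rfl
  obtain ⟨P, hP, rfl⟩ := hc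
  have hP' : MvPolynomial.IsWeightedHomogeneous wt P I := hP
  choose p hp using h1
  refine ⟨∑ e ∈ P.support, Polynomial.C (P.coeff e) * p e, ?_⟩
  change Ideal.Quotient.mk (relIdeal k) P = _
  conv_lhs => rw [P.as_sum]
  rw [map_sum, map_sum, Finset.sum_mul]
  refine Finset.sum_congr rfl fun e he => ?_
  have hw : Finsupp.weight wt e = I := hP' (MvPolynomial.mem_support_iff.1 he)
  have : (MvPolynomial.monomial e (P.coeff e) : MvPolynomial ℤ k) =
      MvPolynomial.C (P.coeff e) * MvPolynomial.monomial e 1 := by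
    rw [MvPolynomial.C_mul_monomial, mul_one]
  rw [this, map_mul, hp, hw, map_mul, mul_assoc]
  congr 1
  exact (Polynomial.aeval_C (x k 0 ^ 2) (P.coeff e)).symm

/-- The point of `Spec C` over `z = c` with values in an algebraic closure of `k` which sends `x_n`
to a chosen square root of `c - n`. -/
theorem exists_point (c : k) : ∃ f : RingC k →ₐ[k] AlgebraicClosure k,
    ∀ n : ℤ, f (x k n) ^ 2 = algebraMap k _ (c - n) := by
  have h : ∀ n : ℤ, ∃ y : AlgebraicClosure k, y ^ 2 = algebraMap k _ (c - n) := fun n =>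
    IsAlgClosed.exists_pow_nat_eq _ two_pos
  choose y hy using h
  refine ⟨Ideal.Quotient.liftₐ (relIdeal k) (MvPolynomial.aeval y) fun a ha => ?_, fun n => ?_⟩
  · have : relIdeal k ≤ RingHom.ker (MvPolynomial.aeval (R := k) y).toRingHom := by
      refine Ideal.span_le.2 ?_
      rintro _ ⟨n, m, rfl⟩
      change MvPolynomial.aeval y _ = 0
      simp [hy]
    exact this ha
  · change (MvPolynomial.aeval y (MvPolynomial.X n)) ^ 2 = _
    rw [MvPolynomial.aeval_X, hy]

variable {k} in
theorem apply_ofPoly {c : k} {f : RingC k →ₐ[k] AlgebraicClosure k}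
    (hf : ∀ n : ℤ, f (x k n) ^ 2 = algebraMap k _ (c - n)) (p : Polynomial k) :
    f (ofPoly k p) = algebraMap k _ (p.eval c) := by
  have h0 := hf 0
  rw [Int.cast_zero, sub_zero] at h0
  rw [ofPoly, ← Polynomial.aeval_algHom_apply, map_pow, h0, Polynomial.aeval_algebraMap_apply]
  simp

/-- The element `x_0²` is transcendental: a polynomial that vanishes at it vanishes at the value `c`
which it takes at the point over `c`, for every `c`. -/
theorem ofPoly_injective [CharZero k] : Function.Injective (ofPoly k) := by
  rw [injective_iff_map_eq_zero]
  intro p hp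
  refine Polynomial.funext fun c => ?_
  obtain ⟨f, hf⟩ := exists_point k c
  have h := apply_ofPoly hf p
  rw [hp, map_zero] at h
  rw [Polynomial.eval_zero]
  exact (FaithfulSMul.algebraMap_injective k (AlgebraicClosure k)) (by rw [← h, map_zero])

variable {k}

theorem ofPoly_mul_xp_eq_zero [CharZero k] {p : Polynomial k} {I : ZFin}
    (h : ofPoly k p * xp k I = 0) : p = 0 := by
  have h1 : ofPoly k (p * rootPoly k (ofBoolRing I)) = 0 := by
    rw [map_mul, ← xp_sq, ← mul_assoc, h, zero_mul]
  have h2 := (injective_iff_map_eq_zero _).1 (ofPoly_injective k) _ h1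
  exact (mul_eq_zero.1 h2).resolve_right (rootPoly_ne_zero k _)

/-- The components of `C` have no `k[z]`-torsion. -/
theorem eq_zero_of_ofPoly_mul [CharZero k] {p : Polynomial k} (hp : p ≠ 0) {I : ZFin} {c : RingC k}
    (hc : c ∈ grading k I) (h : ofPoly k p * c = 0) : c = 0 := by
  obtain ⟨q, rfl⟩ := exists_ofPoly_mul_xp hc
  rw [← mul_assoc, ← map_mul] at h
  rw [(mul_eq_zero.1 (ofPoly_mul_xp_eq_zero h)).resolve_left hp, map_zero, zero_mul]

variable (k)

theorem coe_aeval_z (p : Polynomial k) :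
    ((Polynomial.aeval (z k) p : degZero k) : RingC k) = ofPoly k p := by
  rw [Polynomial.aeval_subalgebra_coe]
  rfl

theorem aeval_z_bijective [CharZero k] : Function.Bijective (Polynomial.aeval (R := k) (z k)) := by
  constructor
  · intro p q h
    refine ofPoly_injective k ?_
    rw [← coe_aeval_z, ← coe_aeval_z, h]
  · rintro ⟨c, hc⟩
    obtain ⟨p, rfl⟩ := exists_ofPoly_mul_xp (I := 0) hc
    refine ⟨p, Subtype.ext ?_⟩
    rw [coe_aeval_z]
    change ofPoly k p = ofPoly k p * xp k 0
    rw [xp_zero, mul_one]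

/-- The isomorphism `k[z] ≅ C_φ`. -/
def polyEquiv [CharZero k] : Polynomial k ≃ₐ[k] degZero k :=
  AlgEquiv.ofBijective (Polynomial.aeval (z k)) (aeval_z_bijective k)

theorem coe_polyEquiv [CharZero k] (p : Polynomial k) :
    (polyEquiv k p : RingC k) = ofPoly k p := coe_aeval_z k p

theorem polyEquiv_X [CharZero k] : polyEquiv k Polynomial.X = z k := Polynomial.aeval_X _

/-! ### Natural endomorphisms of the identity functor -/

open GrMod

/-- The free graded `C`-module with generator in degree `I`. -/
abbrev freeC (I : ZFin) : GrC k := free (grading k) I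

variable {k}

theorem mem_freeC {I J : ZFin} {c : RingC k} (hc : c ∈ grading k (I + J)) :
    (c : (freeC k I).carrier) ∈ (freeC k I).gr J := by
  change c ∈ grading k (-I + J)
  rwa [neg_eq]

theorem of_mem_freeC {I J : ZFin} {c : (freeC k I).carrier} (hc : c ∈ (freeC k I).gr J) :
    (c : RingC k) ∈ grading k (I + J) := by
  change (c : RingC k) ∈ grading k (-I + J) at hc
  rwa [neg_eq] at hc

variable (k) in
/-- The homomorphism from the free module generated in degree `I` to that generated in degree `J`
which sends the generator to `x_{I ⊕ J}`. -/
def xi (I J : ZFin) : freeC k I ⟶ freeC k J :=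
  desc (M := freeC k J) (xp k (J + I)) (mem_freeC (xp_mem k _))

/-- The coefficient of a homomorphism between free modules of rank one: the element of `C` by which
it multiplies. -/
def coeff {I J : ZFin} (f : freeC k I ⟶ freeC k J) : RingC k := gen f

theorem coeff_mem {I J : ZFin} (f : freeC k I ⟶ freeC k J) : coeff f ∈ grading k (J + I) :=
  of_mem_freeC (gen_mem f)

theorem coeff_ext {I J : ZFin} {f g : freeC k I ⟶ freeC k J} (h : coeff f = coeff g) : f = g :=
  free_hom_ext h

theorem coeff_comp {I J K : ZFin} (f : freeC k I ⟶ freeC k J) (g : freeC k J ⟶ freeC k K) :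
    coeff (f ≫ g) = coeff f * coeff g := toLin_eq_smul_gen g (coeff f)

@[simp] theorem coeff_id (I : ZFin) : coeff (𝟙 (freeC k I)) = 1 := rfl

@[simp] theorem coeff_xi (I J : ZFin) : coeff (xi k I J) = xp k (J + I) :=
  one_mul (xp k (J + I))

/-- Homomorphisms between free modules of rank one are polynomial multiples of `xi`. -/
theorem exists_coeff_eq {I J : ZFin} (f : freeC k I ⟶ freeC k J) :
    ∃ p : Polynomial k, coeff f = ofPoly k p * xp k (J + I) :=
  exists_ofPoly_mul_xp (coeff_mem f)

/-- An endomorphism `τ` of the identity functor acts on the free module `C(I)` by a polynomial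
`p_I`; naturality for the homomorphism `x_I : C(I) ⟶ C` shows that all `p_I` agree with `p_∅`, and
naturality for the homomorphisms `C(I) ⟶ M` shows that `τ` is multiplication by `p_∅`. -/
theorem mu_bijective [CharZero k] : Function.Bijective (mu (grading k)) := by
  constructor
  · intro a b h
    have := congrArg (fun τ : 𝟭 (GrC k) ⟶ 𝟭 (GrC k) => gen (τ.app (freeC k 0))) h
    exact Subtype.ext ((mul_one (a : RingC k)).symm.trans (this.trans (mul_one (b : RingC k))))
  · intro τ
    let t : ∀ I, freeC k I ⟶ freeC k I := fun I => τ.app (freeC k I)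
    have hf : ∀ I, ∃ p : Polynomial k, coeff (t I) = ofPoly k p := by
      intro I
      obtain ⟨p, hp⟩ := exists_coeff_eq (t I)
      refine ⟨p, ?_⟩
      rwa [add_self, xp_zero, mul_one] at hp
    choose p hp using hf
    have hp0 : ∀ I, p I = p 0 := by
      intro I
      have h : xi k I 0 ≫ t 0 = t I ≫ xi k I 0 := τ.naturality (xi k I 0)
      have h := congrArg coeff h
      rw [coeff_comp, coeff_comp, hp, hp, coeff_xi, mul_comm, ← sub_eq_zero, ← sub_mul,
        ← map_sub] at h
      exact (sub_eq_zero.1 (ofPoly_mul_xp_eq_zero h)).symm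
    refine ⟨polyEquiv k (p 0), ?_⟩
    ext M : 2
    refine hom_ext_homogeneous fun I m hm => ?_
    change (polyEquiv k (p 0) : RingC k) • m = (τ.app M).toLin m
    have h := congrArg gen (τ.naturality (desc m hm))
    have h1 : gen (desc m hm ≫ τ.app M) = (τ.app M).toLin m := by simp
    have h2 : gen (t I ≫ desc m hm) = ofPoly k (p I) • m := by
      rw [← hp I]
      rfl
    rw [coe_polyEquiv, ← hp0 I, ← h2, ← h1]
    exact h.symm

end RingC

/-! ### Recognising a member of a family of objects of rank one -/

namespace RingC

open Polynomial

variable {k : Type u} [Field k]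

theorem X_sub_C_dvd_rootPoly [CharZero k] {n : ℤ} {I : Finset ℤ}
    (h : (X - C (n : k)) ∣ rootPoly k I) : n ∈ I := by
  obtain ⟨m, hm, hd⟩ := (Polynomial.prime_X_sub_C (n : k)).exists_mem_finset_dvd h
  rw [Polynomial.dvd_iff_isRoot, Polynomial.IsRoot, eval_sub, eval_X, eval_C, sub_eq_zero,
    Int.cast_inj] at hd
  rwa [hd]

theorem rootPoly_dvd_iff [CharZero k] {I J : Finset ℤ} :
    rootPoly k I ∣ rootPoly k J ↔ I ⊆ J :=
  ⟨fun h n hn => X_sub_C_dvd_rootPoly (k := k) (n := n)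
      ((Finset.dvd_prod_of_mem (fun i : ℤ => X - C (i : k)) hn).trans h),
    fun h => Finset.prod_dvd_prod_of_subset I J (fun i : ℤ => X - C (i : k)) h⟩

section RankOne

variable {A : Type v} [Category.{w} A] [Preadditive A] [CategoryTheory.Linear k[X] A]
  {c : A} {Q : ZFin → A}

/-- The set of all composites `c ⟶ Q I ⟶ c`, as polynomials. -/
def traceSet (c : A) (Q : ZFin → A) : Set k[X] :=
  {p | ∃ (I : ZFin) (v : c ⟶ Q I) (u : Q I ⟶ c), v ≫ u = p • 𝟙 c}

/-- If a composite `c ⟶ Q ⟶ c` is a nonzero multiple of the identity of least degree, then its two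
factors generate `Hom(c, Q)` and `Hom(Q, c)`, by division with remainder. -/
theorem exists_smul_of_minimal {Q : A}
    (hQ : ∀ f : Q ⟶ Q, ∃ p : k[X], f = p • 𝟙 Q)
    (hc : ∀ f : c ⟶ c, ∃ p : k[X], f = p • 𝟙 c)
    (hc0 : ∀ p : k[X], p • 𝟙 c = 0 → p = 0)
    (hv : ∀ (v : c ⟶ Q) (p : k[X]), p ≠ 0 → p • v = 0 → v = 0)
    (hu : ∀ (u : Q ⟶ c) (p : k[X]), p ≠ 0 → p • u = 0 → u = 0)
    {v : c ⟶ Q} {u : Q ⟶ c} {a : k[X]} (ha : v ≫ u = a • 𝟙 c) (ha0 : a ≠ 0)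
    (hmin : ∀ (v' : c ⟶ Q) (u' : Q ⟶ c) (b : k[X]), v' ≫ u' = b • 𝟙 c → b ≠ 0 →
      ¬ b.degree < a.degree) :
    (u ≫ v = a • 𝟙 Q) ∧ (∀ v' : c ⟶ Q, ∃ t : k[X], v' = t • v) ∧
      (∀ u' : Q ⟶ c, ∃ t : k[X], u' = t • u) := by
  have huv : u ≫ v = a • 𝟙 Q := by
    obtain ⟨e, he⟩ := hQ (u ≫ v)
    have h1 : (e - a) • v = 0 := by
      have : v ≫ u ≫ v = (v ≫ u) ≫ v := (Category.assoc _ _ _).symm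
      rw [he, ha, Linear.comp_smul, Linear.smul_comp, Category.comp_id, Category.id_comp] at this
      rw [sub_smul, this, sub_self]
    by_cases hea : e - a = 0
    · rw [he, sub_eq_zero.1 hea]
    · have h0 := hv _ _ hea h1
      rw [h0, Limits.zero_comp] at ha
      exact absurd (hc0 a ha.symm) ha0
  refine ⟨huv, fun v' => ?_, fun u' => ?_⟩
  · obtain ⟨b, hb⟩ := hc (v' ≫ u)
    have h1 : (v' - (b / a) • v) ≫ u = (b % a) • 𝟙 c := by
      rw [Preadditive.sub_comp, Linear.smul_comp, hb, ha, smul_smul, ← sub_smul,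
        EuclideanDomain.mod_eq_sub_mul_div, mul_comm]
    have h2 : b % a = 0 := by
      by_contra h
      exact hmin _ _ _ h1 h (EuclideanDomain.mod_lt b ha0)
    have h3 : a • (v' - (b / a) • v) = 0 := by
      rw [h2, zero_smul] at h1
      have := congrArg (· ≫ v) h1
      simp only [Category.assoc, huv, Limits.zero_comp, Linear.comp_smul, Category.comp_id] at this
      exact this
    exact ⟨_, sub_eq_zero.1 (hv _ _ ha0 h3)⟩
  · obtain ⟨b, hb⟩ := hc (v ≫ u')
    have h1 : v ≫ (u' - (b / a) • u) = (b % a) • 𝟙 c := by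
      rw [Preadditive.comp_sub, Linear.comp_smul, hb, ha, smul_smul, ← sub_smul,
        EuclideanDomain.mod_eq_sub_mul_div, mul_comm]
    have h2 : b % a = 0 := by
      by_contra h
      exact hmin _ _ _ h1 h (EuclideanDomain.mod_lt b ha0)
    have h3 : a • (u' - (b / a) • u) = 0 := by
      rw [h2, zero_smul] at h1
      have := congrArg (u ≫ ·) h1
      simp only [← Category.assoc, huv, Limits.comp_zero, Linear.smul_comp, Category.id_comp]
        at this
      exact this
    exact ⟨_, sub_eq_zero.1 (hu _ _ ha0 h3)⟩

/-- The objects `Q I` behave like the free modules `C(I)`: they have endomorphism ring `k[z]`, and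
are linked by homomorphisms `ξ` whose composites are multiplication by `∏_{i ∈ I ⊕ J} (z - i)`. If
an object `c` with endomorphism ring `k[z]` is generated by the `Q I`, then it is one of them.

The composite `c ⟶ Q I ⟶ c` of least degree, multiplication by `a`, is invertible. Otherwise let `q`
be a prime factor of `a`. As the ideal of all composites is the unit ideal, some other composite
`c ⟶ Q I' ⟶ c` is prime to `q`. Comparing the two through `ξ` shows that `q` divides
`∏_{i ∈ I' ⊕ I} (z - i)`, so `q = z - n` for an integer `n`. With `I ⊕ {n}` in place of `I`, both
factors of the minimal composite become divisible by `z - n`, and dividing them gives a composite of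
smaller degree. -/
theorem exists_iso_of_span_traceSet_eq_top [CharZero k]
    (ξ : ∀ I J, Q I ⟶ Q J)
    (hξ : ∀ I J, ξ I J ≫ ξ J I = rootPoly k (ofBoolRing (I + J)) • 𝟙 (Q I))
    (hQ : ∀ (I) (f : Q I ⟶ Q I), ∃ p : k[X], f = p • 𝟙 (Q I))
    (hc : ∀ f : c ⟶ c, ∃ p : k[X], f = p • 𝟙 c)
    (hc0 : ∀ p : k[X], p • 𝟙 c = 0 → p = 0)
    (hv : ∀ (I) (v : c ⟶ Q I) (p : k[X]), p ≠ 0 → p • v = 0 → v = 0)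
    (hu : ∀ (I) (u : Q I ⟶ c) (p : k[X]), p ≠ 0 → p • u = 0 → u = 0)
    (hspan : Ideal.span (traceSet c Q) = (⊤ : Ideal k[X])) :
    ∃ I, Nonempty (c ≅ Q I) := by
  -- the trace ideal is nonzero, so it contains a nonzero composite of least degree
  have hex : ∃ d : WithBot ℕ, ∃ a ∈ traceSet c Q, a ≠ 0 ∧ (a : k[X]).degree = d := by
    by_contra! h
    have : (traceSet c Q : Set k[X]) ⊆ ((⊥ : Ideal k[X]) : Set k[X]) := fun a ha => by
      by_contra h0
      exact h _ a ha h0 rfl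
    have := Ideal.span_le.2 this
    rw [hspan] at this
    exact bot_ne_top (top_le_iff.1 this)
  obtain ⟨d, ⟨a, ⟨I, v, u, ha⟩, ha0, rfl⟩, hmin⟩ := WellFounded.has_min
    (wellFounded_lt (α := WithBot ℕ)) {d | ∃ a ∈ traceSet c Q, a ≠ 0 ∧ (a : k[X]).degree = d} hex
  have hmin' : ∀ b ∈ traceSet c Q, b ≠ 0 → ¬ (b : k[X]).degree < a.degree :=
    fun b hb hb0 => hmin _ ⟨b, hb, hb0, rfl⟩
  obtain ⟨huv, hgv, hgu⟩ := exists_smul_of_minimal (hQ I) hc hc0 (hv I) (hu I) ha ha0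
    fun v' u' b hb => hmin' b ⟨I, v', u', hb⟩
  -- two multiples of the identity of `c` agree only if the factors do
  have hinj : ∀ p q : k[X], p • 𝟙 c = q • 𝟙 c → p = q := fun p q h => by
    rw [← sub_eq_zero, ← sub_smul] at h
    exact sub_eq_zero.1 (hc0 _ h)
  -- transport of composites along `ξ`
  have htr : ∀ (I' J : ZFin) (v' : c ⟶ Q I') (u' : Q I' ⟶ c) (b : k[X]), v' ≫ u' = b • 𝟙 c →
      (v' ≫ ξ I' J) ≫ (ξ J I' ≫ u') = (rootPoly k (ofBoolRing (I' + J)) * b) • 𝟙 c := by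
    intro I' J v' u' b hb
    have h1 := hξ I' J
    have h2 : (v' ≫ ξ I' J) ≫ (ξ J I' ≫ u') = v' ≫ (ξ I' J ≫ ξ J I') ≫ u' := by
      simp only [Category.assoc]
    rw [h2, h1, Linear.smul_comp, Linear.comp_smul, Category.id_comp, hb, smul_smul]
  by_cases hau : IsUnit a
  · obtain ⟨a, rfl⟩ := hau
    refine ⟨I, ⟨⟨v, (↑a⁻¹ : k[X]) • u, ?_, ?_⟩⟩⟩
    · rw [Linear.comp_smul, ha, smul_smul, Units.inv_mul, one_smul]
    · rw [Linear.smul_comp, huv, smul_smul, Units.inv_mul, one_smul]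
  exfalso
  obtain ⟨q, hq, hqa⟩ := WfDvdMonoid.exists_irreducible_factor hau ha0
  obtain ⟨b, ⟨I', v', u', hb⟩, hqb⟩ : ∃ b ∈ traceSet c Q, ¬ q ∣ (b : k[X]) := by
    by_contra! h
    have : Ideal.span (traceSet c Q) ≤ Ideal.span {q} :=
      Ideal.span_le.2 fun b hb => Ideal.mem_span_singleton.2 (h b hb)
    rw [hspan, top_le_iff, Ideal.span_singleton_eq_top] at this
    exact hq.not_isUnit this
  -- `q` divides a polynomial with integral roots, hence is linear
  have hqr : q ∣ rootPoly k (ofBoolRing (I' + I)) := by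
    refine (hq.prime.dvd_or_dvd ?_).resolve_right hqb
    obtain ⟨s, hs⟩ := hgv (v' ≫ ξ I' I)
    obtain ⟨t, ht⟩ := hgu (ξ I I' ≫ u')
    have h := htr I' I v' u' b hb
    rw [hs, ht, Linear.comp_smul, Linear.smul_comp, ha, smul_smul, smul_smul] at h
    rw [← hinj _ _ h]
    exact hqa.mul_left _
  obtain ⟨n, hn, hqn⟩ := hq.prime.exists_mem_finset_dvd hqr
  have hass : Associated q (X - C (n : k)) := hq.associated_of_dvd (irreducible_X_sub_C _) hqn
  set r : k[X] := X - C (n : k) with hr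
  have hrirr : Irreducible r := irreducible_X_sub_C _
  have hra : r ∣ a := hass.symm.dvd.trans hqa
  have hrb : ¬ r ∣ b := fun h => hqb (hass.dvd.trans h)
  -- `I'` can be replaced by the set which differs from `I` exactly at `n`: the composite stays
  -- prime to `z - n`, because `n` lies in `I' ⊕ I` and so not in `I' ⊕ I₂`
  let I₂ : ZFin := I + wt n
  let v₂ := v' ≫ ξ I' I₂
  let u₂ := ξ I₂ I' ≫ u'
  obtain ⟨b₂, hb₂, hrb₂⟩ : ∃ b₂ : k[X], v₂ ≫ u₂ = b₂ • 𝟙 c ∧ ¬ r ∣ b₂ := by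
    refine ⟨_, htr I' I₂ v' u' b hb, fun h => ?_⟩
    have h1 := X_sub_C_dvd_rootPoly ((hrirr.prime.dvd_or_dvd h).resolve_right hrb)
    have h2 : I' + I₂ = (I' + I) + wt n := (add_assoc _ _ _).symm
    rw [h2] at h1
    have h3 : ofBoolRing ((I' + I) + wt n) = symmDiff (ofBoolRing (I' + I)) {n} := rfl
    rw [h3, Finset.mem_symmDiff] at h1
    simp [hn] at h1
  have hI₂ : I + I₂ = wt n := by
    rw [← add_assoc, add_self, zero_add]
  have hI₂' : I₂ + I = wt n := by rw [add_comm, hI₂]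
  have hrp : rootPoly k (ofBoolRing (wt n)) = r := Finset.prod_singleton _ _
  obtain ⟨s, hs⟩ := hgv (v₂ ≫ ξ I₂ I)
  obtain ⟨t, ht⟩ := hgu (ξ I I₂ ≫ u₂)
  obtain ⟨a', rfl⟩ := hra
  have hst : t * s * a' = b₂ := by
    have h := htr I₂ I v₂ u₂ b₂ hb₂
    rw [hs, ht, Linear.comp_smul, Linear.smul_comp, ha, smul_smul, smul_smul, hI₂', hrp] at h
    refine mul_left_cancel₀ hrirr.ne_zero ?_
    rw [← hinj _ _ h]
    ring
  have hrs : ¬ r ∣ s := fun h => hrb₂ (by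
    rw [← hst]
    exact (h.mul_left _).mul_right _)
  have hrt : ¬ r ∣ t := fun h => hrb₂ (by
    rw [← hst]
    exact (h.mul_right _).mul_right _)
  -- hence `v ≫ ξ` and `ξ ≫ u` are divisible by `z - n`
  obtain ⟨w, hw⟩ : ∃ w : c ⟶ Q I₂, v ≫ ξ I I₂ = r • w := by
    have h1 : s • (v ≫ ξ I I₂) = r • v₂ := by
      rw [← Linear.smul_comp, ← hs, Category.assoc, hξ, hI₂', hrp, Linear.comp_smul,
        Category.comp_id]
    obtain ⟨e, f, hef⟩ := (hrirr.coprime_iff_not_dvd).2 hrs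
    refine ⟨e • (v ≫ ξ I I₂) + f • v₂, ?_⟩
    rw [smul_add, smul_smul, smul_comm r f, ← h1, smul_smul, ← add_smul, mul_comm r, hef, one_smul]
  obtain ⟨y, hy⟩ : ∃ y : Q I₂ ⟶ c, ξ I₂ I ≫ u = r • y := by
    have h1 : t • (ξ I₂ I ≫ u) = r • u₂ := by
      rw [← Linear.comp_smul, ← ht, ← Category.assoc, hξ, hI₂', hrp, Linear.smul_comp,
        Category.id_comp]
    obtain ⟨e, f, hef⟩ := (hrirr.coprime_iff_not_dvd).2 hrt
    refine ⟨e • (ξ I₂ I ≫ u) + f • u₂, ?_⟩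
    rw [smul_add, smul_smul, smul_comm r f, ← h1, smul_smul, ← add_smul, mul_comm r, hef, one_smul]
  -- dividing by `z - n` twice and multiplying by it once lowers the degree by one
  obtain ⟨g, hg⟩ := hc (w ≫ y)
  have hga : g = a' := by
    have h := htr I I₂ v u _ ha
    rw [hw, hy, Linear.comp_smul, Linear.smul_comp, hg, smul_smul, smul_smul, hI₂, hrp] at h
    have := hinj _ _ h
    rw [mul_assoc] at this
    have h2 := mul_left_cancel₀ hrirr.ne_zero this
    exact mul_left_cancel₀ hrirr.ne_zero h2
  subst hga
  have hg0 : g ≠ 0 := right_ne_zero_of_mul ha0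
  refine hmin' g ⟨I₂, w, y, hg⟩ hg0 ?_
  rw [degree_mul, hr, degree_X_sub_C, degree_eq_natDegree hg0]
  exact_mod_cast Nat.lt_one_add_iff.2 le_rfl

end RankOne

end RingC

/-! ### Autoequivalences which act trivially on `C_φ` -/

namespace RingC

open Polynomial GrMod

variable {k : Type u} [Field k]

/-- A polynomial in `z` acts on homomorphisms of graded `C`-modules. -/
instance polySMul (M N : GrC k) : SMul k[X] (M ⟶ N) := ⟨fun p f => ⟨ofPoly k p • f.toLin,
  fun i m h => by
    have := N.smul_mem (ofPoly_mem k p) (f.map_mem i m h)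
    rwa [zero_add] at this⟩⟩

@[simp] theorem poly_smul_toLin {M N : GrC k} (p : k[X]) (f : M ⟶ N) :
    (p • f).toLin = ofPoly k p • f.toLin := rfl

instance polyModule (M N : GrC k) : Module k[X] (M ⟶ N) where
  one_smul f := by ext m; simp
  mul_smul a b f := by ext m; simp [mul_smul]
  smul_zero a := by ext m; simp
  smul_add a f g := by ext m; simp
  add_smul a b f := by ext m; simp [add_smul]
  zero_smul f := hom_ext fun m => by
    have h : ofPoly k 0 = 0 := map_zero _
    change ofPoly k 0 • f.toLin m = 0
    rw [h]
    exact zero_smul (RingC k) (f.toLin m)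

/-- The category of graded `C`-modules is linear over `C_φ = k[z]`. -/
instance polyLinear : CategoryTheory.Linear k[X] (GrC k) where
  smul_comp := by
    intros
    ext m
    simp
  comp_smul := by
    intros
    ext m
    simp

@[simp] theorem coeff_poly_smul {I J : ZFin} (p : k[X]) (f : freeC k I ⟶ freeC k J) :
    coeff (p • f) = ofPoly k p * coeff f := rfl

theorem poly_smul_eq_comp_mu [CharZero k] {M N : GrC k} (p : k[X]) (f : M ⟶ N) :
    p • f = f ≫ (mu (grading k) (polyEquiv k p)).app N := by
  refine hom_ext fun m => ?_
  change ofPoly k p • f.toLin m = (polyEquiv k p : RingC k) • f.toLin m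
  rw [coe_polyEquiv]

theorem exists_eq_smul_xi {I J : ZFin} (f : freeC k I ⟶ freeC k J) :
    ∃ p : k[X], f = p • xi k I J := by
  obtain ⟨p, hp⟩ := exists_coeff_eq f
  refine ⟨p, coeff_ext ?_⟩
  rw [hp, coeff_poly_smul, coeff_xi]

theorem exists_eq_smul_id {I : ZFin} (f : freeC k I ⟶ freeC k I) :
    ∃ p : k[X], f = p • 𝟙 (freeC k I) := by
  obtain ⟨p, hp⟩ := exists_coeff_eq f
  refine ⟨p, coeff_ext ?_⟩
  rw [hp, coeff_poly_smul, coeff_id, add_self, xp_zero]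

theorem xi_comp_xi (I J : ZFin) :
    xi k I J ≫ xi k J I = rootPoly k (ofBoolRing (I + J)) • 𝟙 (freeC k I) := by
  refine coeff_ext ?_
  rw [coeff_comp, coeff_xi, coeff_xi, coeff_poly_smul, coeff_id, mul_one, add_comm J I, xp_sq]

theorem smul_id_injective [CharZero k] {I : ZFin} {p q : k[X]}
    (h : p • 𝟙 (freeC k I) = q • 𝟙 (freeC k I)) : p = q := by
  have := congrArg coeff h
  rw [coeff_poly_smul, coeff_poly_smul, coeff_id, mul_one, mul_one] at this
  exact ofPoly_injective k this

/-- Homomorphisms into a free module have no `k[z]`-torsion. -/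
theorem eq_zero_of_poly_smul [CharZero k] {M : GrC k} {J : ZFin} {f : M ⟶ freeC k J} {p : k[X]}
    (hp : p ≠ 0) (h : p • f = 0) : f = 0 := by
  refine hom_ext_homogeneous fun i m hm => ?_
  refine eq_zero_of_ofPoly_mul (I := J + i) hp (of_mem_freeC (f.map_mem i m hm)) ?_
  exact congrArg (fun t : M ⟶ freeC k J => t.toLin m) h

instance mono_xi [CharZero k] (I J : ZFin) : Mono (xi k I J) := by
  refine mono_of_injective _ (injective_of_homogeneous _ fun i (c : RingC k) hc h => ?_)
  have h1 : c * xp k (J + I) = 0 := by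
    rw [← coeff_xi]
    exact (toLin_eq_smul_gen (xi k I J) c).symm.trans h
  refine eq_zero_of_ofPoly_mul (rootPoly_ne_zero k (ofBoolRing (J + I))) (of_mem_freeC hc) ?_
  rw [← xp_sq, mul_assoc, mul_comm _ c, h1, mul_zero]

section Equivalences

variable [CharZero k] (E : GrC k ≌ GrC k)

variable {E} in
/-- If an equivalence sends the free modules generated in degrees `0` and `I` to those generated in
degrees `0` and `K`, then it turns the homomorphisms `x_I` between the former into multiples of the
homomorphisms `x_K` between the latter; hence `x_K²` divides `x_I²`. -/
theorem rootPoly_eq_of_isos [E.functor.Linear k[X]] (e : freeC k 0 ≅ E.functor.obj (freeC k 0))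
    {I K : ZFin} (θ : freeC k K ≅ E.functor.obj (freeC k I)) :
    ∃ p q : k[X], e.hom ≫ E.functor.map (xi k 0 I) ≫ θ.inv = p • xi k 0 K ∧
      θ.hom ≫ E.functor.map (xi k I 0) ≫ e.inv = q • xi k K 0 ∧
      q * p * rootPoly k (ofBoolRing K) = rootPoly k (ofBoolRing I) := by
  obtain ⟨p, hp⟩ := exists_eq_smul_xi (e.hom ≫ E.functor.map (xi k 0 I) ≫ θ.inv)
  obtain ⟨q, hq⟩ := exists_eq_smul_xi (θ.hom ≫ E.functor.map (xi k I 0) ≫ e.inv)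
  refine ⟨p, q, hp, hq, ?_⟩
  have h1 : (e.hom ≫ E.functor.map (xi k 0 I) ≫ θ.inv) ≫
      (θ.hom ≫ E.functor.map (xi k I 0) ≫ e.inv) =
        rootPoly k (ofBoolRing I) • 𝟙 (freeC k 0) := by
    simp only [Category.assoc, Iso.inv_hom_id_assoc]
    rw [← Functor.map_comp_assoc, xi_comp_xi, zero_add]
    simp
  rw [hp, hq, Linear.comp_smul, Linear.smul_comp, xi_comp_xi, zero_add, smul_smul, smul_smul] at h1
  exact smul_id_injective h1

/-- The images of the free modules under an equivalence generate the free modules of rank one: the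
ideal of all elements that factor through them is the unit ideal. -/
theorem span_traceSet_eq_top [E.functor.Additive] (J : ZFin) :
    Ideal.span (traceSet (freeC k J) fun I => E.functor.obj (freeC k I)) = (⊤ : Ideal k[X]) := by
  let S : Set (RingC k) := {s | ∃ (I K : ZFin) (u : E.functor.obj (freeC k I) ⟶ freeC k J),
    ∃ m ∈ (E.functor.obj (freeC k I)).gr K, s = u.toLin m}
  have hS : Ideal.span S = ⊤ := by
    refine span_eq_top_of_forall_hom (𝒜 := grading k) J S ?_ ?_
    · rintro _ ⟨I, K, u, m, hm, rfl⟩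
      exact ⟨J + K, of_mem_freeC (u.map_mem K m hm)⟩
    · intro N f hf
      have h0 : ∀ (I : ZFin) (u : E.functor.obj (freeC k I) ⟶ freeC k J), u ≫ f = 0 :=
        fun I u => hom_ext_homogeneous fun K m hm => hf _ ⟨I, K, u, m, hm, rfl⟩
      by_contra hne
      have hne' : E.inverse.map f ≠ 0 := fun h => hne (E.inverse.map_injective (by simpa using h))
      obtain ⟨I, g, hg⟩ := exists_free_comp_ne_zero hne'
      refine hg (E.functor.map_injective ?_)
      have h1 := h0 I (E.functor.map g ≫ E.counit.app (freeC k J))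
      have h2 : E.functor.map (E.inverse.map f) ≫ E.counit.app N = E.counit.app _ ≫ f :=
        E.counit.naturality f
      rw [← cancel_mono (E.counit.app N), Functor.map_comp, Category.assoc, Functor.map_zero,
        Limits.zero_comp]
      exact ((congrArg (E.functor.map g ≫ ·) h2).trans (Category.assoc _ _ _).symm).trans h1
  -- the degree zero components of the elements of the ideal lie in the trace ideal
  have key : ∀ c ∈ Ideal.span S, ∀ r : RingC k,
      ∃ p ∈ Ideal.span (traceSet (freeC k J) fun I => E.functor.obj (freeC k I)),
        (DirectSum.decompose (grading k) (r * c) 0 : RingC k) = ofPoly k p := by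
    intro c hc
    induction hc using Submodule.span_induction with
    | zero =>
      intro r
      refine ⟨0, zero_mem _, ?_⟩
      simp
    | add a b _ _ ha hb =>
      intro r
      obtain ⟨p, hp, h1⟩ := ha r
      obtain ⟨q, hq, h2⟩ := hb r
      refine ⟨p + q, add_mem hp hq, ?_⟩
      rw [mul_add, DirectSum.decompose_add, DirectSum.add_apply, map_add, ← h1, ← h2]
      rfl
    | smul a b _ hb =>
      intro r
      rw [smul_eq_mul, ← mul_assoc]
      exact hb _
    | mem s hs =>
      obtain ⟨I, K, u, m, hm, rfl⟩ := hs
      intro r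
      let r' : RingC k := (DirectSum.decompose (grading k) r (J + K) : RingC k)
      have hr'm : r' ∈ grading k (J + K) := SetLike.coe_mem _
      have hm' : r' • m ∈ (E.functor.obj (freeC k I)).gr J := by
        have := (E.functor.obj (freeC k I)).smul_mem hr'm hm
        rwa [add_assoc, add_self, add_zero] at this
      obtain ⟨p, hp⟩ := exists_eq_smul_id (desc (r' • m) hm' ≫ u)
      refine ⟨p, Ideal.subset_span ⟨I, _, u, hp⟩, ?_⟩
      let s : RingC k := u.toLin m
      have h1 : (DirectSum.decompose (grading k) (r * s) 0 : RingC k) =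
          r' * s := by
        have := DirectSum.coe_decompose_mul_add_of_right_mem (grading k) (a := r) (i := J + K)
          (of_mem_freeC (u.map_mem K m hm))
        rwa [add_self] at this
      have h2 := congrArg coeff hp
      rw [coeff_poly_smul, coeff_id, mul_one] at h2
      refine h1.trans (Eq.trans ?_ h2)
      have h3 : coeff (desc (r' • m) hm' ≫ u) = u.toLin (r' • m) :=
        congrArg u.toLin (gen_desc (r' • m) hm')
      exact (h3.trans (u.toLin.map_smul r' m)).symm
  obtain ⟨p, hp, h1⟩ := key 1 (by rw [hS]; trivial) 1
  rw [mul_one, DirectSum.decompose_of_mem_same _ (SetLike.one_mem_graded (grading k))] at h1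
  have h2 : p = 1 := ofPoly_injective k (by rw [← h1, map_one])
  rw [Ideal.eq_top_iff_one, ← h2]
  exact hp

variable [E.functor.Additive] [E.functor.Linear k[X]]

/-- A `k[z]`-linear autoequivalence permutes the free modules of rank one. -/
theorem exists_free_iso (J : ZFin) :
    ∃ I, Nonempty (freeC k J ≅ E.functor.obj (freeC k I)) := by
  refine exists_iso_of_span_traceSet_eq_top (c := freeC k J)
    (Q := fun I => E.functor.obj (freeC k I)) (fun I J => E.functor.map (xi k I J))
    (fun I J => ?_) (fun I f => ?_) exists_eq_smul_id (fun p h => ?_) (fun I v p hp h => ?_)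
    (fun I u p hp h => eq_zero_of_poly_smul hp h) (span_traceSet_eq_top E J)
  · rw [← Functor.map_comp, xi_comp_xi, Functor.map_smul, CategoryTheory.Functor.map_id]
  · obtain ⟨p, hp⟩ := exists_eq_smul_id (E.functor.preimage f)
    refine ⟨p, ?_⟩
    rw [← E.functor.map_id, ← Functor.map_smul, ← hp, Functor.map_preimage]
  · exact smul_id_injective (by rw [h, zero_smul])
  · let w := E.functor.preimage (E.counit.app (freeC k J) ≫ v)
    have hw : E.functor.map w = E.counit.app (freeC k J) ≫ v := Functor.map_preimage _ _
    have h1 : p • w = 0 := E.functor.map_injective (by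
      rw [Functor.map_smul, hw, ← Linear.comp_smul, h, Limits.comp_zero, Functor.map_zero])
    rw [eq_zero_of_poly_smul hp h1, Functor.map_zero] at hw
    rw [← cancel_epi (E.counit.app (freeC k J)), Limits.comp_zero]
    exact hw.symm

variable {E} in
/-- A `k[z]`-linear autoequivalence which fixes the free module generated in degree zero fixes all
free modules of rank one, compatibly with the homomorphisms `x_I` into it. -/
theorem exists_iso_comp_map_xi (e : freeC k 0 ≅ E.functor.obj (freeC k 0)) (I : ZFin) :
    ∃ θ : freeC k I ≅ E.functor.obj (freeC k I),
      θ.hom ≫ E.functor.map (xi k I 0) = xi k I 0 ≫ e.hom := by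
  have : E.symm.functor.Additive := inferInstanceAs E.inverse.Additive
  have : E.symm.functor.Linear k[X] := inferInstanceAs (E.inverse.Linear k[X])
  obtain ⟨K, ⟨θ'⟩⟩ := exists_free_iso E.symm I
  let θ : freeC k K ≅ E.functor.obj (freeC k I) :=
    (E.counitIso.app (freeC k K)).symm ≪≫ (E.functor.mapIso θ').symm
  obtain ⟨p, q, -, hq, hpq⟩ := rootPoly_eq_of_isos e θ
  have hKI : ofBoolRing K ⊆ ofBoolRing I := rootPoly_dvd_iff.1 ⟨_, by rw [mul_comm, hpq]⟩
  have hIK : ofBoolRing I ⊆ ofBoolRing K := by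
    obtain ⟨p', q', -, -, h'⟩ := rootPoly_eq_of_isos (E := E.symm)
      (E.unitIso.app (freeC k 0) ≪≫ (E.inverse.mapIso e).symm) θ'
    exact rootPoly_dvd_iff.1 ⟨_, by rw [mul_comm, h']⟩
  obtain rfl : K = I := hKI.antisymm hIK
  have h1 : q * p = 1 := by
    refine mul_right_cancel₀ (rootPoly_ne_zero k (ofBoolRing K)) ?_
    rw [hpq, one_mul]
  refine ⟨⟨p • θ.hom, q • θ.inv, ?_, ?_⟩, ?_⟩
  · rw [Linear.comp_smul, Linear.smul_comp, θ.hom_inv_id, smul_smul, h1, one_smul]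
  · rw [Linear.comp_smul, Linear.smul_comp, θ.inv_hom_id, smul_smul, mul_comm, h1, one_smul]
  · have h2 : θ.hom ≫ E.functor.map (xi k K 0) = (q • xi k K 0) ≫ e.hom := by
      rw [← hq]
      simp
    change (p • θ.hom) ≫ _ = _
    rw [Linear.smul_comp, h2, Linear.smul_comp, smul_smul, mul_comm, h1, one_smul]

variable {E} in
/-- A `k[z]`-linear autoequivalence which fixes the free module generated in degree zero is
isomorphic to the identity: the component `M_I = Hom(C(I), M)` is identified with
`Hom(E C(I), E M) = Hom(C(I), E M) = (E M)_I`. -/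
theorem nonempty_iso_id (e : freeC k 0 ≅ E.functor.obj (freeC k 0)) :
    Nonempty (𝟭 (GrC k) ≅ E.functor) := by
  choose θ hθ using exists_iso_comp_map_xi e
  -- the isomorphisms commute with all homomorphisms between free modules, since these become
  -- multiples of `x_I` after composition with the monomorphism `x_K`
  have hnat : ∀ {I K : ZFin} (h : freeC k I ⟶ freeC k K),
      (θ I).hom ≫ E.functor.map h = h ≫ (θ K).hom := by
    intro I K h
    have : Mono (E.functor.map (xi k K 0)) := inferInstance
    rw [← cancel_mono (E.functor.map (xi k K 0)), Category.assoc, Category.assoc,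
      ← Functor.map_comp, hθ]
    obtain ⟨p, hp⟩ := exists_eq_smul_xi (h ≫ xi k K 0)
    rw [← Category.assoc, hp, Functor.map_smul, Linear.comp_smul, hθ, Linear.smul_comp]
  -- an element `m` of degree `I`, seen as a homomorphism from the free module, is mapped by `E`
  let φ : ∀ (M : GrC k) (I : ZFin), M.gr I →+ (E.functor.obj M).gr I := fun M I =>
    { toFun := fun m => ⟨gen ((θ I).hom ≫ E.functor.map (desc m.1 m.2)), gen_mem _⟩
      map_zero' := by
        have : desc (J := I) ((0 : M.gr I) : M.carrier) (0 : M.gr I).2 = 0 :=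
          free_hom_ext (by simp)
        refine Subtype.ext ?_
        change gen _ = 0
        rw [this, Functor.map_zero, Limits.comp_zero, gen_zero]
      map_add' := fun m n => by
        have : desc (J := I) ((m + n : M.gr I) : M.carrier) (m + n).2 =
            desc m.1 m.2 + desc n.1 n.2 := by
          refine free_hom_ext ((gen_desc _ _).trans ?_)
          change (m : M.carrier) + n = gen (desc m.1 m.2) + gen (desc n.1 n.2)
          rw [gen_desc, gen_desc]
        refine Subtype.ext ?_
        change gen _ = gen _ + gen _
        rw [this, Functor.map_add, Preadditive.comp_add]
        rfl }
  have hφ : ∀ (M : GrC k) (I : ZFin) (m : M.carrier) (hm : m ∈ M.gr I),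
      (φ M I ⟨m, hm⟩ : (E.functor.obj M).carrier) =
        gen ((θ I).hom ≫ E.functor.map (desc m hm)) := fun _ _ _ _ => rfl
  have hsmul : ∀ (M : GrC k) {i j : ZFin} {a : RingC k} (ha : a ∈ grading k i) (m : M.gr j),
      (φ M (i + j) ⟨a • (m : M.carrier), M.smul_mem ha m.2⟩ : (E.functor.obj M).carrier) =
        a • (φ M j m : (E.functor.obj M).carrier) := by
    rintro M i j a ha ⟨m, hm⟩
    have ha' : a ∈ grading k (j + (i + j)) := by
      rwa [add_left_comm, add_self, add_zero]
    let A : freeC k (i + j) ⟶ freeC k j := desc (M := freeC k j) a (mem_freeC ha')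
    have hgA : (gen A : RingC k) = a := one_mul a
    have hA : desc (a • m) (M.smul_mem ha hm) = A ≫ desc m hm := by
      refine free_hom_ext ?_
      rw [gen_comp, gen_desc]
      exact (congrArg (fun r : RingC k => r • m) hgA).symm
    rw [hφ, hφ, hA, Functor.map_comp, ← Category.assoc, hnat, Category.assoc, gen_comp]
    exact (toLin_eq_smul_gen (𝒜 := grading k) _ _).trans
      (congrArg (fun r : RingC k => r • gen ((θ j).hom ≫ E.functor.map (desc m hm))) hgA)
  choose f hf using fun M => exists_hom_of_components (φ M) (hsmul M)
  have hf' : ∀ (M : GrC k) (I : ZFin) (m : M.carrier) (hm : m ∈ M.gr I),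
      (f M).toLin m = gen ((θ I).hom ≫ E.functor.map (desc m hm)) :=
    fun M I m hm => hf M I ⟨m, hm⟩
  have hiso : ∀ M, IsIso (f M) := by
    intro M
    refine isIso_of_bijective _ ⟨injective_of_homogeneous _ fun I m hm h => ?_,
      surjective_of_homogeneous _ fun I n hn => ?_⟩
    · rw [hf' M I m hm] at h
      have h1 : (θ I).hom ≫ E.functor.map (desc m hm) = 0 := free_hom_ext h
      rw [← Limits.comp_zero (f := (θ I).hom), cancel_epi] at h1
      have h2 : desc m hm = 0 := E.functor.map_injective (h1.trans (Functor.map_zero _ _ _).symm)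
      rw [← gen_desc m hm, h2, gen_zero]
    · let w := E.functor.preimage ((θ I).inv ≫ desc n hn)
      have hw : E.functor.map w = (θ I).inv ≫ desc n hn := Functor.map_preimage _ _
      refine ⟨gen w, ?_⟩
      have h1 : desc (gen w) (gen_mem w) = w := free_hom_ext (gen_desc _ _)
      rw [hf' M I _ (gen_mem w), h1, hw, Iso.hom_inv_id_assoc, gen_desc]
  refine ⟨NatIso.ofComponents (fun M => (asIso (f M) : M ≅ E.functor.obj M)) fun {M N} g => ?_⟩
  refine hom_ext_homogeneous fun I m hm => ?_
  change (f N).toLin (g.toLin m) = (E.functor.map g).toLin ((f M).toLin m)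
  have h1 : desc (g.toLin m) (g.map_mem I m hm) = desc m hm ≫ g :=
    free_hom_ext (by rw [gen_comp, gen_desc, gen_desc])
  rw [hf' M I m hm, hf' N I _ (g.map_mem I m hm), h1, Functor.map_comp, ← Category.assoc,
    gen_comp]

end Equivalences

end RingC

/-! ### The action of the Picard group on `C_φ` -/

namespace RingC

open GrMod

variable {k : Type u} [Field k] [CharZero k]

omit [CharZero k] in
theorem mu_add_app (a b : degZero k) (N : GrC k) :
    (mu (grading k) (a + b)).app N = (mu (grading k) a).app N + (mu (grading k) b).app N :=
  hom_ext fun m => add_smul (a : RingC k) (b : RingC k) m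

omit [CharZero k] in
theorem mu_mul_app (a b : degZero k) (N : GrC k) :
    (mu (grading k) (a * b)).app N = (mu (grading k) b).app N ≫ (mu (grading k) a).app N :=
  hom_ext fun m => mul_smul (a : RingC k) (b : RingC k) m

omit [CharZero k] in
theorem mu_algebraMap_app (c : k) (N : GrC k) :
    (mu (grading k) (algebraMap k (degZero k) c)).app N = c • 𝟙 N := rfl

/-- The endomap of `C_φ` induced by an autoequivalence through `C_φ = End(id)`. -/
def alphaFun (F : LinAutoEquiv k (GrC k)) (a : degZero k) : degZero k :=
  (Equiv.ofBijective _ mu_bijective).symm (F.conj (mu (grading k) a))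

theorem mu_alphaFun (F : LinAutoEquiv k (GrC k)) (a : degZero k) :
    mu (grading k) (alphaFun F a) = F.conj (mu (grading k) a) :=
  (Equiv.ofBijective _ mu_bijective).apply_symm_apply _

theorem map_mu_app (F : LinAutoEquiv k (GrC k)) (a : degZero k) (N : GrC k) :
    F.toEquiv.functor.map ((mu (grading k) a).app N) =
      (mu (grading k) (alphaFun F a)).app (F.obj N) := by
  rw [mu_alphaFun, F.conj_app_obj]

theorem alphaFun_eq_of_conj {F : LinAutoEquiv k (GrC k)} {a b : degZero k}
    (h : F.conj (mu (grading k) a) = mu (grading k) b) : alphaFun F a = b :=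
  mu_bijective.1 ((mu_alphaFun F a).trans h)

theorem alphaFun_eq_of_app {F : LinAutoEquiv k (GrC k)} {a b : degZero k}
    (h : ∀ N, F.toEquiv.functor.map ((mu (grading k) a).app N) =
      (mu (grading k) b).app (F.obj N)) : alphaFun F a = b :=
  alphaFun_eq_of_conj (F.conj_eq_of_app h)

/-- `alphaFun` as an algebra homomorphism. -/
def alphaHom (F : LinAutoEquiv k (GrC k)) : degZero k →ₐ[k] degZero k :=
  have hadd := F.additive
  have hlin := F.linear
  have halg : ∀ c : k, alphaFun F (algebraMap k (degZero k) c) = algebraMap k (degZero k) c :=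
    fun c => alphaFun_eq_of_app fun N => by
      rw [mu_algebraMap_app, mu_algebraMap_app, Functor.map_smul]
      exact congrArg (c • ·) (F.toEquiv.functor.map_id N)
  { toFun := alphaFun F
    map_one' := by simpa using halg 1
    map_zero' := by simpa using halg 0
    map_mul' := fun a b => alphaFun_eq_of_app fun N => by
      rw [mu_mul_app, mu_mul_app, Functor.map_comp, map_mu_app, map_mu_app]
    map_add' := fun a b => alphaFun_eq_of_app fun N => by
      rw [mu_add_app, mu_add_app, Functor.map_add, map_mu_app, map_mu_app]
    commutes' := halg }

theorem alphaFun_comp (F G : LinAutoEquiv k (GrC k)) (a : degZero k) :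
    alphaFun (F.comp G) a = alphaFun F (alphaFun G a) :=
  alphaFun_eq_of_conj (by rw [LinAutoEquiv.conj_comp, mu_alphaFun, mu_alphaFun])

/-- The algebra automorphism of `C_φ` induced by an autoequivalence. -/
def alphaEquiv (F : LinAutoEquiv k (GrC k)) : degZero k ≃ₐ[k] degZero k :=
  AlgEquiv.ofAlgHom (alphaHom F) (alphaHom F.symm)
    (AlgHom.ext fun a => alphaFun_eq_of_conj (by
      change F.conj (mu (grading k) (alphaFun F.symm a)) = _
      rw [mu_alphaFun, LinAutoEquiv.conj_conj_symm]
      rfl))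
    (AlgHom.ext fun a => alphaFun_eq_of_conj (by
      change F.symm.conj (mu (grading k) (alphaFun F a)) = _
      rw [mu_alphaFun, LinAutoEquiv.conj_symm_conj]
      rfl))

variable (k) in
/-- The action of the Picard group on `C_φ`. -/
def alpha : Pic k →* (degZero k ≃ₐ[k] degZero k) :=
  MonoidHom.mk' (Quotient.lift alphaEquiv (by
    rintro F G ⟨e⟩
    refine AlgEquiv.ext fun a => alphaFun_eq_of_conj ?_
    rw [LinAutoEquiv.conj_eq_of_iso e]
    exact (mu_alphaFun G a).symm)) (by
    rintro ⟨F⟩ ⟨G⟩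
    exact AlgEquiv.ext fun a => alphaFun_comp F G a)

theorem alpha_mk (F : LinAutoEquiv k (GrC k)) (a : degZero k) :
    alpha k (PicardGroup.mk F) a = alphaFun F a := rfl

/-! ### Twists -/

omit [CharZero k] in
theorem mk_twist_add (I J : ZFin) :
    (PicardGroup.mk (twist k (I + J)) : Pic k) =
      PicardGroup.mk (twist k I) * PicardGroup.mk (twist k J) := by
  refine PicardGroup.sound (F := twist k (I + J)) (G := (twist k I).comp (twist k J)) ?_
  refine NatIso.ofComponents (fun M => isoMk (M := twistObj (I + J) M)
    (N := twistObj I (twistObj J M)) (LinearEquiv.refl _ M.carrier) ?_) fun _ => rfl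
  intro i m
  change m ∈ M.gr (I + J + i) ↔ m ∈ M.gr (J + (I + i))
  rw [add_comm I J, add_assoc]

omit [CharZero k] in
theorem mk_twist_zero : (PicardGroup.mk (twist k (0 : ZFin)) : Pic k) = 1 := by
  have := mk_twist_add (k := k) 0 0
  rw [add_zero] at this
  exact left_eq_mul.1 this

variable (k) in
/-- The homomorphism which sends a finite set of integers to the class of its twist functor. -/
def twistHom : Multiplicative ZFin →* Pic k where
  toFun J := PicardGroup.mk (twist k J.toAdd)
  map_one' := mk_twist_zero
  map_mul' I J := mk_twist_add I.toAdd J.toAdd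

theorem alphaFun_twist (J : ZFin) (a : degZero k) : alphaFun (twist k J) a = a :=
  alphaFun_eq_of_app fun _ => rfl

theorem alpha_twistHom (J : Multiplicative ZFin) : alpha k (twistHom k J) = 1 :=
  AlgEquiv.ext fun a => alphaFun_twist J.toAdd a

/-- An isomorphism of the twist `(J)` with the identity gives a unit of `C` in degree `J`; its
square is a multiple of `x_J²`, so that `x_J²` is constant and `J` is empty. -/
theorem twistHom_injective : Function.Injective (twistHom k) := by
  rw [injective_iff_map_eq_one]
  intro J hJ
  obtain ⟨e⟩ : Nonempty ((twist k J.toAdd).toEquiv.functor ≅ 𝟭 (GrC k)) := Quotient.exact hJ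
  let e0 : twistObj J.toAdd (freeC k 0) ≅ freeC k 0 := e.app (freeC k 0)
  -- the images of the generator under the isomorphism and its inverse are inverse to each other
  have h1 : ((e0.hom.toLin (1 : RingC k) : RingC k)) ∈ grading k J.toAdd := by
    have : e0.hom.toLin (1 : RingC k) ∈ (freeC k 0).gr J.toAdd := by
      refine e0.hom.map_mem _ _ ?_
      change (1 : RingC k) ∈ grading k (-0 + (J.toAdd + J.toAdd))
      rw [add_self, neg_zero, add_zero]
      exact SetLike.one_mem_graded _
    have := of_mem_freeC this
    rwa [zero_add] at this
  have h2 : ((e0.inv.toLin (1 : RingC k) : RingC k)) ∈ grading k J.toAdd := by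
    have : e0.inv.toLin (1 : RingC k) ∈ (twistObj J.toAdd (freeC k 0)).gr 0 :=
      e0.inv.map_mem _ _ (one_mem_free (𝒜 := grading k) 0)
    have : (e0.inv.toLin (1 : RingC k) : RingC k) ∈ grading k (-0 + (J.toAdd + 0)) := this
    rwa [neg_zero, add_zero, zero_add] at this
  obtain ⟨p, hp⟩ := exists_ofPoly_mul_xp h1
  obtain ⟨q, hq⟩ := exists_ofPoly_mul_xp h2
  have h3 : (ofPoly k p * xp k J.toAdd) * (ofPoly k q * xp k J.toAdd) = 1 := by
    rw [← hp, ← hq]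
    have h4 : e0.inv.toLin (e0.hom.toLin (1 : RingC k)) = (1 : RingC k) :=
      congrArg (fun t : twistObj J.toAdd (freeC k 0) ⟶ _ => t.toLin (1 : RingC k)) e0.hom_inv_id
    exact (toLin_eq_smul_gen (𝒜 := grading k) (J := 0) e0.inv _).symm.trans h4
  have h5 : p * q * rootPoly k (ofBoolRing J.toAdd) = 1 := by
    refine ofPoly_injective k ?_
    rw [map_mul, map_mul, ← xp_sq, map_one, ← h3]
    ring
  have h6 : rootPoly k (ofBoolRing J.toAdd) ∣ rootPoly k ∅ :=
    (isUnit_of_dvd_one ⟨p * q, by rw [← h5, mul_comm]⟩).dvd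
  exact Finset.subset_empty.1 (rootPoly_dvd_iff.1 h6)

/-- An autoequivalence which acts trivially on `C_φ` is a twist: it is `k[z]`-linear, hence permutes
the free modules of rank one, and becomes the identity after a twist which brings `C` back. -/
theorem exists_twist_of_alpha_eq_one {P : Pic k} (hP : alpha k P = 1) : ∃ J, twistHom k J = P := by
  -- an autoequivalence with trivial action is `k[z]`-linear
  have hlin : ∀ F : LinAutoEquiv k (GrC k), alpha k (PicardGroup.mk F) = 1 →
      F.toEquiv.functor.Linear (Polynomial k) := fun F hF => ⟨fun {X Y} f r => by
    rw [poly_smul_eq_comp_mu, poly_smul_eq_comp_mu, Functor.map_comp, map_mu_app, ← alpha_mk, hF]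
    rfl⟩
  obtain ⟨F, rfl⟩ : ∃ F, PicardGroup.mk F = P := Quotient.exists_rep P
  have hF1 := F.additive
  have hF2 := hlin F hP
  obtain ⟨I, ⟨e⟩⟩ := exists_free_iso F.toEquiv 0
  let F' := F.comp (twist k I)
  have hF' : alpha k (PicardGroup.mk F') = 1 := by
    have : (PicardGroup.mk F' : Pic k) =
        PicardGroup.mk F * twistHom k (Multiplicative.ofAdd I) := rfl
    rw [this, map_mul, hP, alpha_twistHom, one_mul]
  have hF1' := F'.additive
  have hF2' := hlin F' hF'
  let e' : twistObj I (freeC k 0) ≅ freeC k I := isoMk (LinearEquiv.refl _ (RingC k)) (by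
    intro i m
    change m ∈ grading k (-0 + (I + i)) ↔ m ∈ grading k (-I + i)
    rw [neg_zero, zero_add, neg_eq])
  obtain ⟨η⟩ := nonempty_iso_id (E := F'.toEquiv) (e ≪≫ (F.toEquiv.functor.mapIso e').symm)
  have h1 : (PicardGroup.mk F * twistHom k (Multiplicative.ofAdd I) : Pic k) = 1 :=
    PicardGroup.sound (F := F') (G := LinAutoEquiv.refl k (GrC k)) η.symm
  refine ⟨(Multiplicative.ofAdd I)⁻¹, ?_⟩
  rw [map_inv]
  exact (eq_inv_of_mul_eq_one_left h1).symm

end RingC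

/-! ### Simple graded modules -/

namespace GrMod

section Transitive

variable {k R : Type u} {Γ : Type w} [CommRing k] [CommRing R] [Algebra k R]
  [AddCommGroup Γ] [DecidableEq Γ] {𝒜 : Γ → Submodule k R}

/-- A graded module is transitive if it is nonzero and each nonzero homogeneous element generates
it. -/
def IsTransitive (M : GrMod 𝒜) : Prop :=
  (∃ m : M.carrier, m ≠ 0) ∧
    ∀ (i : Γ), ∀ m ∈ M.gr i, m ≠ 0 → ∀ m' : M.carrier, ∃ r : R, r • m = m'

theorem IsTransitive.simple {M : GrMod 𝒜} [GradedAlgebra 𝒜] (hM : M.IsTransitive) : Simple M where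
  mono_isIso_iff_nonzero {Y} f _ := by
    constructor
    · rintro _ rfl
      obtain ⟨m, hm⟩ := hM.1
      have h : 𝟙 M = 0 := by
        rw [← IsIso.inv_hom_id (0 : Y ⟶ M), comp_zero]
      exact hm (congrArg (fun t : M ⟶ M => t.toLin m) h)
    · intro hf
      obtain ⟨i, y, hy, hfy⟩ := exists_ne_zero_of_hom hf
      refine isIso_of_bijective f ⟨injective_of_mono f, fun m => ?_⟩
      obtain ⟨r, hr⟩ := hM.2 i _ (f.map_mem i y hy) hfy m
      exact ⟨r • y, by rw [map_smul, hr]⟩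

/-- A nonzero homomorphism from a transitive module to a simple one is an isomorphism. -/
theorem IsTransitive.isIso {M N : GrMod 𝒜} (hM : M.IsTransitive) [Simple N] {f : M ⟶ N}
    (hf : f ≠ 0) : IsIso f := by
  have : Mono f := mono_of_injective f (injective_of_homogeneous f fun i m hm h => by
    by_contra hm0
    refine hf (hom_ext fun m' => ?_)
    obtain ⟨r, rfl⟩ := hM.2 i m hm hm0 m'
    rw [map_smul, h, smul_zero]
    rfl)
  exact isIso_of_mono_of_nonzero hf

/-- The homomorphism from a cyclic module which sends the generator to a given element of degree
zero. -/
def cyclicDesc [GradedAlgebra 𝒜] {a : R} {ha : SetLike.IsHomogeneousElem 𝒜 a} {M : GrMod 𝒜}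
    (m : M.carrier) (hm : m ∈ M.gr 0) (h : a • m = 0) : cyclic a ha ⟶ M where
  toLin := (Ideal.span {a}).liftQ (LinearMap.toSpanSingleton R M.carrier m)
    (Ideal.span_le.2 (by
      rintro _ rfl
      exact h))
  map_mem := by
    rintro i _ ⟨r, hr, rfl⟩
    have := M.smul_mem (show r ∈ 𝒜 i from hr) hm
    rwa [add_zero] at this

theorem cyclicDesc_ne_zero [GradedAlgebra 𝒜] {a : R} {ha : SetLike.IsHomogeneousElem 𝒜 a}
    {M : GrMod 𝒜} {m : M.carrier} (hm : m ∈ M.gr 0) (h : a • m = 0) (hm0 : m ≠ 0) :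
    cyclicDesc (ha := ha) m hm h ≠ 0 := fun h0 => by
  have := congrArg (fun t : cyclic a ha ⟶ M => t.toLin (Ideal.Quotient.mk (Ideal.span {a}) 1)) h0
  exact hm0 ((one_smul R m).symm.trans this)

end Transitive

end GrMod

namespace RingC

open GrMod Polynomial

variable {k : Type u} [Field k]

/-- The graded module `M` is supported at the point `z = c` (scheme-theoretically): it is killed by
`z - c`. -/
def AtPoint (c : k) (M : GrC k) : Prop := ∀ m : M.carrier, ofPoly k (X - C c) • m = 0

theorem AtPoint.ofPoly_smul {c : k} {M : GrC k} (hM : AtPoint c M) (p : k[X]) (m : M.carrier) :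
    ofPoly k p • m = algebraMap k (RingC k) (p.eval c) • m := by
  obtain ⟨q, hq⟩ : X - C c ∣ p - C (p.eval c) := X_sub_C_dvd_sub_C_eval
  have h : p = q * (X - C c) + C (p.eval c) := by
    rw [mul_comm, ← hq, sub_add_cancel]
  have hC : ofPoly k (C (p.eval c)) = algebraMap k (RingC k) (p.eval c) := aeval_C _ _
  conv_lhs => rw [h]
  rw [map_add, map_mul, add_smul, mul_smul, hM, smul_zero, zero_add, hC]

theorem algebraMap_smul_eq_zero {M : GrC k} {c : k} {m : M.carrier}
    (h : algebraMap k (RingC k) c • m = 0) (hm : m ≠ 0) : c = 0 := by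
  by_contra hc
  refine hm ?_
  have : (algebraMap k (RingC k) c⁻¹ * algebraMap k (RingC k) c) • m = 0 := by
    rw [mul_smul, h, smul_zero]
  rwa [← map_mul, inv_mul_cancel₀ hc, map_one, one_smul] at this

theorem AtPoint.eq {c d : k} {M : GrC k} (hc : AtPoint c M) (hd : AtPoint d M) {m : M.carrier}
    (hm : m ≠ 0) : c = d := by
  have h := hc.ofPoly_smul (X - C d) m
  rw [hd m, eval_sub, eval_X, eval_C] at h
  exact sub_eq_zero.1 (algebraMap_smul_eq_zero h.symm hm)

theorem atPoint_iff_poly_smul {c : k} {M : GrC k} : AtPoint c M ↔ (X - C c) • 𝟙 M = 0 :=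
  ⟨fun h => hom_ext h, fun h m => congrArg (fun t : M ⟶ M => t.toLin m) h⟩

theorem AtPoint.of_mono {c : k} {M N : GrC k} (hN : AtPoint c N) (f : M ⟶ N) [Mono f] :
    AtPoint c M := by
  rw [atPoint_iff_poly_smul] at hN ⊢
  rw [← cancel_mono f, Linear.smul_comp, Category.id_comp, Limits.zero_comp,
    ← Category.comp_id f, ← Linear.comp_smul, hN, Limits.comp_zero]

theorem AtPoint.biprod {c : k} {M N : GrC k} (hM : AtPoint c M) (hN : AtPoint c N) :
    AtPoint c (M ⊞ N) := by
  rw [atPoint_iff_poly_smul] at *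
  refine biprod.hom_ext' _ _ ?_ ?_
  · rw [Linear.comp_smul, Category.comp_id, Limits.comp_zero, ← Category.id_comp biprod.inl,
      ← Linear.smul_comp, hM, Limits.zero_comp]
  · rw [Linear.comp_smul, Category.comp_id, Limits.comp_zero, ← Category.id_comp biprod.inr,
      ← Linear.smul_comp, hN, Limits.zero_comp]

theorem AtPoint.twist {c : k} {M : GrC k} (hM : AtPoint c M) (J : ZFin) :
    AtPoint c (twistObj J M) := hM

theorem AtPoint.xp_smul_xp_smul {c : k} {M : GrC k} (hM : AtPoint c M) (I : ZFin)
    (m : M.carrier) : xp k I • xp k I • m =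
      algebraMap k (RingC k) ((rootPoly k (ofBoolRing I)).eval c) • m := by
  rw [← mul_smul, xp_sq, hM.ofPoly_smul]

theorem AtPoint.xp_smul_ne_zero {c : k} {M : GrC k} (hM : AtPoint c M) {I : ZFin}
    (hI : (rootPoly k (ofBoolRing I)).eval c ≠ 0) {m : M.carrier} (hm : m ≠ 0) :
    xp k I • m ≠ 0 := fun h => by
  have := hM.xp_smul_xp_smul I m
  rw [h, smul_zero] at this
  exact hI (algebraMap_smul_eq_zero this.symm hm)

theorem eval_rootPoly_ne_zero {c : k} {I : Finset ℤ} (h : ∀ n ∈ I, (n : k) ≠ c) :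
    (rootPoly k I).eval c ≠ 0 := by
  rw [rootPoly, eval_prod, Finset.prod_ne_zero_iff]
  intro n hn
  rw [eval_sub, eval_X, eval_C]
  exact sub_ne_zero.2 (h n hn).symm

theorem ofPoly_X_sub_C (c : k) :
    ofPoly k (X - C c) = x k 0 ^ 2 - algebraMap k (RingC k) c := by
  rw [map_sub]
  exact congrArg₂ _ (aeval_X _) (aeval_C _ _)

theorem atPoint_cyclic {a : RingC k} {ha : SetLike.IsHomogeneousElem (grading k) a} {c : k}
    (h : a ∣ ofPoly k (X - C c)) : AtPoint c (cyclic a ha) := by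
  intro m
  obtain ⟨r, rfl⟩ := Ideal.Quotient.mk_surjective m
  refine Ideal.Quotient.eq_zero_iff_mem.2 (Ideal.mul_mem_right _ _ ?_)
  exact Ideal.mem_span_singleton.2 h

theorem atPoint_modO (c : k) : AtPoint c (modO k c) :=
  atPoint_cyclic (by rw [ofPoly_X_sub_C])

theorem atPoint_modX (n : ℤ) : AtPoint (n : k) (modX k n) :=
  atPoint_cyclic (by
    rw [← x_sq]
    exact dvd_pow_self _ two_ne_zero)

theorem atPoint_modY (n : ℤ) : AtPoint (n : k) (modY k n) := (atPoint_modX n).twist _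

/-- Multiplication by `b x_I` can be undone on modules at points where `x_I²` does not vanish. -/
theorem AtPoint.exists_smul_eq {c : k} {M : GrC k} (hM : AtPoint c M) {I : ZFin} {b : k}
    (hb : b ≠ 0) (hI : (rootPoly k (ofBoolRing I)).eval c ≠ 0) (r : RingC k) (m : M.carrier) :
    ∃ r' : RingC k, r' • algebraMap k (RingC k) b • xp k I • m = r • m := by
  refine ⟨r * algebraMap k (RingC k) (b * (rootPoly k (ofBoolRing I)).eval c)⁻¹ * xp k I, ?_⟩
  rw [mul_smul, smul_comm (xp k I) (algebraMap k (RingC k) b), hM.xp_smul_xp_smul, ← mul_smul,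
    ← mul_smul, mul_assoc, ← map_mul, mul_assoc, ← map_mul, inv_mul_cancel₀ (mul_ne_zero hb hI),
    map_one, mul_one]

/-- A cyclic module `C/(a)` supported at `z = c` is transitive if each `x_I` is either a multiple of
`a` or acts invertibly at `c`. -/
theorem isTransitive_cyclic {a : RingC k} {ha : SetLike.IsHomogeneousElem (grading k) a} {c : k}
    (hc : AtPoint c (cyclic a ha)) (h : ∀ I, a ∣ xp k I ∨ (rootPoly k (ofBoolRing I)).eval c ≠ 0)
    {f : RingC k →ₐ[k] AlgebraicClosure k} (hf : f a = 0) : (cyclic a ha).IsTransitive := by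
  let e : (cyclic a ha).carrier := Ideal.Quotient.mk (Ideal.span {a}) 1
  have hgen : ∀ r : RingC k, r • e = Ideal.Quotient.mk (Ideal.span {a}) r := fun r =>
    congrArg (Ideal.Quotient.mk (Ideal.span {a})) (mul_one r)
  refine ⟨⟨e, fun h => ?_⟩, ?_⟩
  · obtain ⟨b, hb⟩ := Ideal.mem_span_singleton.1 (Ideal.Quotient.eq_zero_iff_mem.1 h)
    have := congrArg f hb
    rw [map_one, map_mul, hf, zero_mul] at this
    exact one_ne_zero this
  · rintro I _ ⟨r, hr, rfl⟩ hm m'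
    obtain ⟨p, rfl⟩ := exists_ofPoly_mul_xp (show r ∈ grading k I from hr)
    change Ideal.Quotient.mk (Ideal.span {a}) (ofPoly k p * xp k I) ≠ 0 at hm
    change ∃ r : RingC k, r • (Ideal.Quotient.mk (Ideal.span {a}) (ofPoly k p * xp k I) :
      (cyclic a ha).carrier) = m'
    have hI : (rootPoly k (ofBoolRing I)).eval c ≠ 0 := by
      refine (h I).resolve_left fun h1 => hm ?_
      exact Ideal.Quotient.eq_zero_iff_mem.2 (Ideal.mem_span_singleton.2 (h1.mul_left _))
    have h1 : (Ideal.Quotient.mk (Ideal.span {a}) (ofPoly k p * xp k I) :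
        (cyclic a ha).carrier) = algebraMap k (RingC k) (p.eval c) • xp k I • e := by
      rw [← hgen, mul_smul, hc.ofPoly_smul]
    have hp : p.eval c ≠ 0 := fun h0 => hm (by
      rw [h0, map_zero] at h1
      exact h1.trans (zero_smul (RingC k) (xp k I • e)))
    obtain ⟨r', rfl⟩ := Ideal.Quotient.mk_surjective m'
    obtain ⟨r, hr⟩ := hc.exists_smul_eq hp hI r' e
    exact ⟨r, (congrArg (r • ·) h1).trans (hr.trans (hgen r'))⟩

theorem isTransitive_modO {c : k} (hc : c ∉ Set.range (Int.cast : ℤ → k)) :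
    (modO k c).IsTransitive := by
  obtain ⟨f, hf⟩ := exists_point k c
  refine isTransitive_cyclic (f := f) (atPoint_modO c) (fun I => Or.inr ?_) ?_
  · exact eval_rootPoly_ne_zero fun n _ h => hc ⟨n, h⟩
  · rw [← ofPoly_X_sub_C, apply_ofPoly hf]
    simp

theorem x_dvd_xp {n : ℤ} {I : ZFin} (h : n ∈ ofBoolRing I) : x k n ∣ xp k I :=
  Finset.dvd_prod_of_mem _ h

theorem isTransitive_modX [CharZero k] (n : ℤ) : (modX k n).IsTransitive := by
  obtain ⟨f, hf⟩ := exists_point k (n : k)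
  refine isTransitive_cyclic (f := f) (atPoint_modX n) (fun I => ?_) ?_
  · by_cases h : n ∈ ofBoolRing I
    · exact Or.inl (x_dvd_xp h)
    · refine Or.inr (eval_rootPoly_ne_zero fun m hm hmn => h ?_)
      rwa [← Int.cast_injective hmn]
  · have := hf n
    rw [sub_self, map_zero] at this
    exact pow_eq_zero_iff two_ne_zero |>.1 this

/-- The module `X_n` vanishes in degree `{n}`. -/
theorem modX_gr_wt {n : ℤ} {m : (modX k n).carrier} (hm : m ∈ (modX k n).gr (wt n)) : m = 0 := by
  obtain ⟨r, hr, rfl⟩ := hm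
  obtain ⟨p, rfl⟩ := exists_ofPoly_mul_xp (show r ∈ grading k (wt n) from hr)
  refine Ideal.Quotient.eq_zero_iff_mem.2 (Ideal.mem_span_singleton.2 ?_)
  rw [xp_wt]
  exact dvd_mul_left _ _

instance simple_modX [CharZero k] (n : ℤ) : Simple (modX k n) := (isTransitive_modX n).simple

instance simple_modY [CharZero k] (n : ℤ) : Simple (modY k n) :=
  simple_obj (twistEquiv (grading k) (ZFin.of {n})).functor (modX k n)

/-- The module `X_n` is generated in degree `∅`, and the component of `Y_n` in degree `∅`, which is
that of `X_n` in degree `{n}`, vanishes. -/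
theorem isEmpty_modX_iso_modY [CharZero k] (n : ℤ) : IsEmpty (modX k n ≅ modY k n) := by
  refine ⟨fun e => ?_⟩
  let g : (modX k n).carrier := Ideal.Quotient.mk (Ideal.span {x k n}) 1
  have hg : g ∈ (modX k n).gr 0 := ⟨1, SetLike.one_mem_graded (grading k), rfl⟩
  have h1 : e.hom.toLin g ∈ (modX k n).gr (wt n + 0) := e.hom.map_mem 0 g hg
  rw [add_zero] at h1
  have h2 : e.hom.toLin g = 0 := modX_gr_wt h1
  have h3 : e.inv.toLin (e.hom.toLin g) = g :=
    congrArg (fun t : modX k n ⟶ modX k n => t.toLin g) e.hom_inv_id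
  have h4 : g = 0 := by
    rw [← h3, h2, map_zero]
  obtain ⟨m, hm⟩ := (isTransitive_modX (k := k) n).1
  obtain ⟨r, rfl⟩ := Ideal.Quotient.mk_surjective m
  refine hm ?_
  have h5 : (Ideal.Quotient.mk (Ideal.span {x k n}) r : (modX k n).carrier) = r • g :=
    congrArg (Ideal.Quotient.mk (Ideal.span {x k n})) (mul_one r).symm
  rw [h5, h4, smul_zero]

theorem exists_homogeneous_of_simple (S : GrC k) [Simple S] : ∃ I, ∃ s ∈ S.gr I, s ≠ 0 := by
  obtain ⟨I, s, hs, h⟩ := exists_ne_zero_of_hom (id_nonzero S)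
  exact ⟨I, s, hs, h⟩

/-- The only simple module at a point `c` outside `ℤ` is `𝒪_c`: each `x_I` is invertible there, so
that a simple module has nonzero elements in degree `∅`. -/
theorem nonempty_modO_iso {c : k} (hc : c ∉ Set.range (Int.cast : ℤ → k)) {S : GrC k} [Simple S]
    (hS : AtPoint c S) : Nonempty (modO k c ≅ S) := by
  obtain ⟨I, s, hs, hs0⟩ := exists_homogeneous_of_simple S
  have h1 : xp k I • s ∈ S.gr 0 := by
    have := S.smul_mem (xp_mem k I) hs
    rwa [add_self] at this
  have h2 : xp k I • s ≠ 0 :=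
    hS.xp_smul_ne_zero (eval_rootPoly_ne_zero fun n _ h => hc ⟨n, h⟩) hs0
  have h3 : (x k 0 ^ 2 - algebraMap k (RingC k) c) • xp k I • s = 0 := by
    rw [← ofPoly_X_sub_C]
    exact hS _
  have := (isTransitive_modO hc).isIso (f := cyclicDesc _ h1 h3) (cyclicDesc_ne_zero h1 h3 h2)
  exact ⟨asIso (cyclicDesc _ h1 h3)⟩

theorem nonempty_modX_iso [CharZero k] {n : ℤ} {S : GrC k} [Simple S] {s : S.carrier}
    (hs : s ∈ S.gr 0) (hs0 : s ≠ 0) (h : x k n • s = 0) : Nonempty (modX k n ≅ S) := by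
  have := (isTransitive_modX n).isIso (f := cyclicDesc _ hs h) (cyclicDesc_ne_zero hs h hs0)
  exact ⟨asIso (cyclicDesc _ hs h)⟩

theorem nonempty_modY_iso [CharZero k] {n : ℤ} {S : GrC k} [Simple S] {s : S.carrier}
    (hs : s ∈ S.gr (wt n)) (hs0 : s ≠ 0) (h : x k n • s = 0) : Nonempty (modY k n ≅ S) := by
  let T := twistEquiv (grading k) (wt n)
  have : Simple (T.functor.obj S) := simple_obj T.functor S
  have hs' : s ∈ (twistObj (wt n) S).gr 0 := by
    change s ∈ S.gr (wt n + 0)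
    rwa [add_zero]
  obtain ⟨e⟩ := nonempty_modX_iso (S := T.functor.obj S) hs' hs0 h
  refine ⟨T.functor.mapIso e ≪≫ isoMk (M := twistObj (wt n) (twistObj (wt n) S)) (N := S)
    (LinearEquiv.refl _ S.carrier) fun i m => ?_⟩
  change m ∈ S.gr (wt n + (wt n + i)) ↔ m ∈ S.gr i
  rw [← add_assoc, add_self, zero_add]

/-- The only simple modules at the point `z = n` are `X_n` and `Y_n`. -/
theorem nonempty_modX_or_modY_iso [CharZero k] {n : ℤ} {S : GrC k} [Simple S]
    (hS : AtPoint (n : k) S) : Nonempty (modX k n ≅ S) ∨ Nonempty (modY k n ≅ S) := by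
  have hxx : ∀ s : S.carrier, x k n • x k n • s = 0 := fun s => by
    rw [← mul_smul, ← sq, x_sq]
    exact hS s
  have hwt : ∀ {I : ZFin} {s : S.carrier}, s ∈ S.gr I → x k n • s ∈ S.gr (wt n + I) :=
    fun hs => S.smul_mem (x_mem k n) hs
  -- it suffices to find a nonzero element in degree `∅` or `{n}`
  suffices h : ∃ s : S.carrier, s ≠ 0 ∧ (s ∈ S.gr 0 ∨ s ∈ S.gr (wt n)) by
    obtain ⟨s, hs0, hs⟩ := h
    by_cases hx : x k n • s = 0
    · exact hs.imp (fun h => nonempty_modX_iso h hs0 hx) fun h => nonempty_modY_iso h hs0 hx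
    · refine hs.symm.imp (fun h => nonempty_modX_iso ?_ hx (hxx s)) fun h =>
        nonempty_modY_iso ?_ hx (hxx s)
      · have := hwt h
        rwa [add_self] at this
      · have := hwt h
        rwa [add_zero] at this
  -- multiplication by `x_K` is injective at `z = n` if `n ∉ K`
  obtain ⟨I, s, hs, hs0⟩ := exists_homogeneous_of_simple S
  have key : ∀ K : ZFin, n ∉ ofBoolRing K → xp k K • s ≠ 0 := fun K hK =>
    hS.xp_smul_ne_zero (eval_rootPoly_ne_zero fun m hm hmn => hK (by
      rwa [← Int.cast_injective hmn])) hs0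
  by_cases hn : n ∈ ofBoolRing I
  · have hn' : n ∉ ofBoolRing (wt n + I) := by
      change n ∉ symmDiff {n} (ofBoolRing I)
      simp [Finset.mem_symmDiff, hn]
    refine ⟨_, key _ hn', Or.inr ?_⟩
    have := S.smul_mem (xp_mem k (wt n + I)) hs
    rwa [add_assoc, add_self, add_zero] at this
  · refine ⟨_, key _ hn, Or.inl ?_⟩
    have := S.smul_mem (xp_mem k I) hs
    rwa [add_self] at this

end RingC

/-! ### Regrading along an affine permutation of `ℤ` -/

namespace RingC

open GrMod Polynomial

variable {k : Type u} [Field k]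

open scoped IsMulCommutative in
/-- Commuting operators `T_n` on a vector space for which `T_n² + n` does not depend on `n` define
an action of `C`. -/
theorem exists_algHom_end {V : Type*} [AddCommGroup V] [Module k V] (T : ℤ → Module.End k V)
    (hcomm : ∀ i j, T i * T j = T j * T i)
    (hrel : ∀ n m : ℤ, T n ^ 2 + algebraMap k _ (n : k) = T m ^ 2 + algebraMap k _ (m : k)) :
    ∃ f : RingC k →ₐ[k] Module.End k V, ∀ n, f (x k n) = T n := by
  -- polynomials can be evaluated in the commutative subalgebra generated by the operators
  obtain ⟨A, hA, hTA⟩ : ∃ A : Subalgebra k (Module.End k V), IsMulCommutative A ∧ ∀ n, T n ∈ A :=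
    ⟨Algebra.adjoin k (Set.range T), Algebra.isMulCommutative_adjoin k (by
      rintro _ ⟨i, rfl⟩ _ ⟨j, rfl⟩
      exact hcomm i j), fun n => Algebra.subset_adjoin ⟨n, rfl⟩⟩
  let t : ℤ → A := fun n => ⟨T n, hTA n⟩
  have ht : ∀ n m : ℤ, t n ^ 2 + algebraMap k A (n : k) = t m ^ 2 + algebraMap k A (m : k) :=
    fun n m => Subtype.ext (hrel n m)
  refine ⟨A.val.comp (Ideal.Quotient.liftₐ (relIdeal k) (MvPolynomial.aeval t) fun a ha => ?_),
    fun n => ?_⟩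
  · have : relIdeal k ≤ RingHom.ker (MvPolynomial.aeval (R := k) t).toRingHom := by
      refine Ideal.span_le.2 ?_
      rintro _ ⟨n, m, rfl⟩
      change MvPolynomial.aeval t _ = 0
      rw [map_sub, map_add, map_add, map_pow, map_pow, MvPolynomial.aeval_X, MvPolynomial.aeval_X,
        MvPolynomial.aeval_C, MvPolynomial.aeval_C, ht n m, sub_self]
    exact this ha
  · change ((MvPolynomial.aeval t (MvPolynomial.X n) : A) : Module.End k V) = _
    rw [MvPolynomial.aeval_X]

/-- An additive map which is compatible with the action of the scalars and of the generators is
`C`-linear. -/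
theorem map_smul_of_generators {M N : GrC k} (g : M.carrier →+ N.carrier)
    (hc : ∀ (c : k) (m : M.carrier),
      g (algebraMap k (RingC k) c • m) = algebraMap k (RingC k) c • g m)
    (hx : ∀ (n : ℤ) (m : M.carrier), g (x k n • m) = x k n • g m) (a : RingC k) (m : M.carrier) :
    g (a • m) = a • g m := by
  obtain ⟨P, rfl⟩ := Ideal.Quotient.mk_surjective a
  induction P using MvPolynomial.induction_on generalizing m with
  | C c => exact hc c m
  | add p q hp hq => rw [map_add, add_smul, map_add, hp, hq, add_smul]
  | mul_X p n hp =>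
    have : Ideal.Quotient.mk (relIdeal k) (p * MvPolynomial.X n) =
      Ideal.Quotient.mk (relIdeal k) p * x k n := map_mul _ _ _
    rw [this, mul_smul, mul_smul, hp, hx]

/-- The permutation of the finite subsets of `ℤ` induced by a permutation of `ℤ`. -/
def mapFin (s : ℤ ≃ ℤ) (I : ZFin) : ZFin := toBoolRing ((ofBoolRing I).map s.toEmbedding)

theorem mem_mapFin {s : ℤ ≃ ℤ} {I : ZFin} {n : ℤ} :
    s n ∈ ofBoolRing (mapFin s I) ↔ n ∈ ofBoolRing I :=
  Finset.mem_map' s.toEmbedding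

theorem ext_mem {I J : ZFin} (h : ∀ n, n ∈ ofBoolRing I ↔ n ∈ ofBoolRing J) : I = J :=
  Finset.ext (α := ℤ) h

theorem mem_add {I J : ZFin} {n : ℤ} : n ∈ ofBoolRing (I + J) ↔
    (n ∈ ofBoolRing I ∧ n ∉ ofBoolRing J ∨ n ∈ ofBoolRing J ∧ n ∉ ofBoolRing I) :=
  Finset.mem_symmDiff

theorem mem_wt {m n : ℤ} : m ∈ ofBoolRing (wt n) ↔ m = n := Finset.mem_singleton

theorem mapFin_add (s : ℤ ≃ ℤ) (I J : ZFin) : mapFin s (I + J) = mapFin s I + mapFin s J := by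
  refine ext_mem fun n => ?_
  obtain ⟨n, rfl⟩ := s.surjective n
  rw [mem_add, mem_mapFin, mem_mapFin, mem_mapFin, mem_add]

theorem mapFin_wt (s : ℤ ≃ ℤ) (n : ℤ) : mapFin s (wt n) = wt (s n) := Finset.map_singleton _ _

theorem mapFin_mapFin_symm (s : ℤ ≃ ℤ) (I : ZFin) : mapFin s (mapFin s.symm I) = I := by
  refine ext_mem fun n => ?_
  obtain ⟨n, rfl⟩ := s.surjective n
  rw [mem_mapFin]
  conv_lhs => rw [← s.symm_apply_apply n]
  exact mem_mapFin

/-- The sign by which the operator attached to `x_j` is modified in degree `K`. -/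
def sgn (ε : ℤˣ) (j : ℤ) (K : ZFin) : ℤ := if j ∈ ofBoolRing K then ε else 1

theorem sgn_add_wt_same (ε : ℤˣ) (j : ℤ) (K : ZFin) :
    sgn ε j (wt j + K) * sgn ε j K = ε := by
  unfold sgn
  by_cases h : j ∈ ofBoolRing K <;> simp [mem_add, mem_wt, h]

theorem sgn_add_wt_of_ne (ε : ℤˣ) {i j : ℤ} (hij : i ≠ j) (K : ZFin) :
    sgn ε i (wt j + K) = sgn ε i K := by
  unfold sgn
  by_cases h : i ∈ ofBoolRing K <;> simp [mem_add, mem_wt, h, hij]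

theorem sgn_mul_sgn (ε : ℤˣ) (j : ℤ) (K : ZFin) : sgn ε j K * sgn ε j K = 1 := by
  unfold sgn
  split_ifs
  · rw [← Units.val_mul, Int.units_mul_self, Units.val_one]
  · rfl

/-- Multiplication by `x_j`, with the sign `ε` on the components whose degree contains `j`. For
`ε = -1` the square of this operator is `-x_j²`, and the operators for different `j` commute. -/
def signedX (ε : ℤˣ) (M : GrC k) (j : ℤ) : M.carrier →+ M.carrier :=
  ofComponents fun K => (sgn ε j K) • (DistribSMul.toAddMonoidHom M.carrier (x k j)).comp
    (M.gr K).subtype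

theorem signedX_apply {ε : ℤˣ} {M : GrC k} {j : ℤ} {K : ZFin} {m : M.carrier} (hm : m ∈ M.gr K) :
    signedX ε M j m = sgn ε j K • x k j • m :=
  ofComponents_apply _ hm

theorem signedX_mem {ε : ℤˣ} {M : GrC k} {j : ℤ} {K : ZFin} {m : M.carrier} (hm : m ∈ M.gr K) :
    signedX ε M j m ∈ M.gr (wt j + K) := by
  rw [signedX_apply hm]
  exact zsmul_mem (M.smul_mem (x_mem k j) hm) _

theorem signedX_signedX (ε : ℤˣ) (M : GrC k) (j : ℤ) (m : M.carrier) :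
    signedX ε M j (signedX ε M j m) = (ε : ℤ) • x k j ^ 2 • m := by
  have : (signedX ε M j).comp (signedX ε M j) =
      (ε : ℤ) • DistribSMul.toAddMonoidHom M.carrier (x k j ^ 2) := by
    refine addHom_ext fun K m hm => ?_
    change signedX ε M j (signedX ε M j m) = (ε : ℤ) • x k j ^ 2 • m
    rw [signedX_apply (signedX_mem hm), signedX_apply hm, smul_comm (x k j), ← mul_smul,
      sgn_add_wt_same, ← mul_smul, sq]
  exact DFunLike.congr_fun this m

theorem signedX_comm (ε : ℤˣ) (M : GrC k) (i j : ℤ) (m : M.carrier) :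
    signedX ε M i (signedX ε M j m) = signedX ε M j (signedX ε M i m) := by
  have : (signedX ε M i).comp (signedX ε M j) = (signedX ε M j).comp (signedX ε M i) := by
    by_cases hij : i = j
    · rw [hij]
    refine addHom_ext fun K m hm => ?_
    change signedX ε M i (signedX ε M j m) = signedX ε M j (signedX ε M i m)
    rw [signedX_apply (signedX_mem hm), signedX_apply hm, signedX_apply (signedX_mem hm),
      signedX_apply hm, sgn_add_wt_of_ne ε hij, sgn_add_wt_of_ne ε (Ne.symm hij),
      smul_comm (x k i) (sgn ε j K), smul_comm (x k j) (sgn ε i K), smul_comm (x k i) (x k j),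
      smul_comm (sgn ε i K)]
  exact DFunLike.congr_fun this m

theorem map_signedX {M N : GrC k} (f : M ⟶ N) (ε : ℤˣ) (j : ℤ) (m : M.carrier) :
    f.toLin (signedX ε M j m) = signedX ε N j (f.toLin m) := by
  have : f.toLin.toAddMonoidHom.comp (signedX ε M j) =
      (signedX ε N j).comp f.toLin.toAddMonoidHom := by
    refine addHom_ext fun K m hm => ?_
    change f.toLin (signedX ε M j m) = signedX ε N j (f.toLin m)
    rw [signedX_apply hm, signedX_apply (f.map_mem K m hm), map_zsmul, map_smul]
  exact DFunLike.congr_fun this m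

theorem signedX_algebraMap_smul (ε : ℤˣ) (M : GrC k) (j : ℤ) (c : k) (m : M.carrier) :
    signedX ε M j (algebraMap k (RingC k) c • m) =
      algebraMap k (RingC k) c • signedX ε M j m :=
  (map_signedX (c • 𝟙 M) ε j m).symm

/-- The permutations of `ℤ` of the form `n ↦ ε n + d`. -/
structure Affine (ε : ℤˣ) (s : ℤ ≃ ℤ) : Prop where
  apply_eq : ∀ n, s n = ε * n + s 0

theorem Affine.symm {ε : ℤˣ} {s : ℤ ≃ ℤ} (hs : Affine ε s) : Affine ε s.symm := by
  have h : ∀ n, s.symm n = ε * (n - s 0) := fun n => by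
    rw [Equiv.symm_apply_eq, hs.apply_eq, ← mul_assoc, ← Units.val_mul, Int.units_mul_self]
    simp
  exact ⟨fun n => by rw [h n, h 0]; ring⟩

theorem x_sq_smul {M : GrC k} (j : ℤ) (m : M.carrier) :
    x k j ^ 2 • m = x k 0 ^ 2 • m - j • m := by
  have h : x k j ^ 2 = x k 0 ^ 2 - (j : RingC k) := by
    have := x_sq_add k j 0
    rw [Int.cast_zero, map_zero, add_zero, map_intCast] at this
    rw [← this, add_sub_cancel_right]
  rw [h, sub_smul, Int.cast_smul_eq_zsmul]

/-- The action of `C` in which `x_n` acts through the signed multiplication by `x_{s n}`. -/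
theorem exists_regradeAction {ε : ℤˣ} {s : ℤ ≃ ℤ} (hs : Affine ε s) (M : GrC k) :
    ∃ f : RingC k →+* AddMonoid.End M.carrier,
      (∀ n m, f (x k n) m = signedX ε M (s n) m) ∧
      ∀ c m, f (algebraMap k (RingC k) c) m = algebraMap k (RingC k) c • m := by
  let _ : Module k M.carrier := Module.compHom M.carrier (algebraMap k (RingC k))
  let T : ℤ → Module.End k M.carrier := fun n =>
    { signedX ε M (s n) with
      map_smul' := fun c m => signedX_algebraMap_smul ε M (s n) c m }
  have hT : ∀ n m, T n m = signedX ε M (s n) m := fun _ _ => rfl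
  obtain ⟨f, hf⟩ := exists_algHom_end T
    (fun i j => LinearMap.ext fun m => signedX_comm ε M (s i) (s j) m) (fun n m => by
      have h : ∀ (n : ℤ) (m : M.carrier), (T n ^ 2 + algebraMap k (Module.End k M.carrier) (n : k) :
          Module.End k M.carrier) m =
          (ε : ℤ) • x k 0 ^ 2 • m - (ε * s 0) • m := fun n m => by
        have h1 : (T n ^ 2 + algebraMap k (Module.End k M.carrier) (n : k) :
          Module.End k M.carrier) m =
            signedX ε M (s n) (signedX ε M (s n) m) + algebraMap k (RingC k) (n : k) • m := by
          rw [sq]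
          rfl
        rw [h1, signedX_signedX, x_sq_smul, hs.apply_eq, map_intCast, Int.cast_smul_eq_zsmul,
          smul_sub, ← mul_smul, mul_add, ← mul_assoc, ← Units.val_mul, Int.units_mul_self,
          Units.val_one, one_mul, add_smul]
        abel
      exact LinearMap.ext fun v => (h n v).trans (h m v).symm)
  refine ⟨(Module.toAddMonoidEnd (Module.End k M.carrier) M.carrier).comp f.toRingHom, ?_, ?_⟩
  · intro n m
    change f (x k n) m = _
    rw [hf]
    rfl
  · intro c m
    change f (algebraMap k (RingC k) c) m = _
    rw [f.commutes]
    rfl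

/-- The ring homomorphism defining the regraded action. -/
def regradeAction {ε : ℤˣ} {s : ℤ ≃ ℤ} (hs : Affine ε s) (M : GrC k) :
    RingC k →+* AddMonoid.End M.carrier := (exists_regradeAction hs M).choose

theorem regradeAction_x {ε : ℤˣ} {s : ℤ ≃ ℤ} (hs : Affine ε s) (M : GrC k) (n : ℤ)
    (m : M.carrier) : regradeAction hs M (x k n) m = signedX ε M (s n) m :=
  (exists_regradeAction hs M).choose_spec.1 n m

theorem regradeAction_algebraMap {ε : ℤˣ} {s : ℤ ≃ ℤ} (hs : Affine ε s) (M : GrC k) (c : k)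
    (m : M.carrier) : regradeAction hs M (algebraMap k (RingC k) c) m =
      algebraMap k (RingC k) c • m :=
  (exists_regradeAction hs M).choose_spec.2 c m

/-- The regraded action respects the relabelled grading; this is checked on the generators `x_n`. -/
theorem regradeAction_mem {ε : ℤˣ} {s : ℤ ≃ ℤ} (hs : Affine ε s) (M : GrC k) {I K : ZFin}
    {a : RingC k} (ha : a ∈ grading k I) {m : M.carrier} (hm : m ∈ M.gr (mapFin s K)) :
    regradeAction hs M a m ∈ M.gr (mapFin s (I + K)) := by
  have hx : ∀ (n : ℤ) (K : ZFin) (m : M.carrier), m ∈ M.gr (mapFin s K) →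
      regradeAction hs M (x k n) m ∈ M.gr (mapFin s (wt n + K)) := fun n K m hm => by
    rw [regradeAction_x, mapFin_add, mapFin_wt]
    exact signedX_mem hm
  have hp : ∀ (p : k[X]) (K : ZFin) (m : M.carrier), m ∈ M.gr (mapFin s K) →
      regradeAction hs M (ofPoly k p) m ∈ M.gr (mapFin s K) := by
    intro p
    have hC : ∀ (c : k) (K : ZFin) (m : M.carrier), m ∈ M.gr (mapFin s K) →
        regradeAction hs M (ofPoly k (C c)) m ∈ M.gr (mapFin s K) := fun c K m hm => by
      have h1 : ofPoly k (C c) = algebraMap k (RingC k) c := aeval_C _ _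
      rw [h1, regradeAction_algebraMap]
      exact (c • 𝟙 M : M ⟶ M).map_mem _ m hm
    induction p using Polynomial.induction_on with
    | C c => exact hC c
    | add p q hp hq =>
      intro K m hm
      rw [map_add, map_add]
      exact add_mem (hp K m hm) (hq K m hm)
    | monomial n c ih =>
      intro K m hm
      have h1 : ofPoly k (C c * X ^ (n + 1)) = ofPoly k (C c * X ^ n) * (x k 0 * x k 0) := by
        have : ofPoly k X = x k 0 * x k 0 := (aeval_X _).trans (sq _)
        rw [pow_succ, ← mul_assoc, map_mul, this]
      rw [h1, map_mul (regradeAction hs M), map_mul (regradeAction hs M) (x k 0)]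
      refine ih K _ ?_
      have := hx 0 _ _ (hx 0 K m hm)
      rwa [← add_assoc, two_wt, zero_add] at this
  have hxp : ∀ (t : Finset ℤ) (K : ZFin) (m : M.carrier), m ∈ M.gr (mapFin s K) →
      regradeAction hs M (xp k (ZFin.of t)) m ∈ M.gr (mapFin s (ZFin.of t + K)) := by
    intro t
    induction t using Finset.induction_on with
    | empty =>
      intro K m hm
      have h1 : xp k (ZFin.of ∅) = 1 := xp_zero k
      rw [h1, map_one, ← zfin_zero, zero_add]
      exact hm
    | insert n t hn ih =>
      intro K m hm
      have h1 : xp k (ZFin.of (insert n t)) = x k n * xp k (ZFin.of t) := Finset.prod_insert hn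
      have h2 : ZFin.of (insert n t) = wt n + ZFin.of t := by
        refine ext_mem fun l => ?_
        rw [mem_add, mem_wt]
        change l ∈ insert n t ↔ (l = n ∧ l ∉ t ∨ l ∈ t ∧ ¬ l = n)
        rw [Finset.mem_insert]
        by_cases hl : l = n
        · subst hl
          simp [hn]
        · simp [hl]
      rw [h1, map_mul, h2, add_assoc]
      exact hx _ _ _ (ih K m hm)
  obtain ⟨p, rfl⟩ := exists_ofPoly_mul_xp ha
  rw [map_mul]
  exact hp _ _ _ (hxp (ofBoolRing I) K m hm)

/-- The graded module with the components of `M` relabelled along `s`, on which `x_n` acts as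
the signed multiplication by `x_{s n}`. -/
def regradeObj {ε : ℤˣ} {s : ℤ ≃ ℤ} (hs : Affine ε s) (M : GrC k) : GrC k where
  carrier := M.carrier
  isModule := Module.compHom M.carrier (regradeAction hs M)
  gr I := M.gr (mapFin s I)
  isInternal := by
    refine isInternal_of_proj _ (fun i => M.proj (mapFin s i)) (fun i x hx => proj_of_mem hx)
      (fun i j x hx hij => proj_of_mem_ne hx fun h => hij ?_) fun x => ?_
    · refine ext_mem fun n => ?_
      rw [← mem_mapFin (s := s), h, mem_mapFin]
    · have hx : x ∈ AddSubmonoid.closure (⋃ i, (M.gr i : Set M.carrier)) := by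
        rw [closure_gr]
        trivial
      refine AddSubmonoid.closure_mono ?_ hx
      intro y hy
      obtain ⟨i, hi⟩ := Set.mem_iUnion.mp hy
      refine Set.mem_iUnion.mpr ⟨mapFin s.symm i, ?_⟩
      change y ∈ M.gr (mapFin s (mapFin s.symm i))
      rwa [mapFin_mapFin_symm]
  smul_mem ha hm := regradeAction_mem hs M ha hm

/-- The scalar action on a graded module, with the module explicit: two modules with the same
underlying group but different actions of `C` have to be distinguished. -/
def act (M : GrC k) (a : RingC k) (m : M.carrier) : M.carrier := a • m

theorem act_regradeObj_x {ε : ℤˣ} {s : ℤ ≃ ℤ} (hs : Affine ε s) (M : GrC k) (n : ℤ)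
    (m : M.carrier) : act (regradeObj hs M) (x k n) m = signedX ε M (s n) m :=
  regradeAction_x hs M n m

theorem act_regradeObj_algebraMap {ε : ℤˣ} {s : ℤ ≃ ℤ} (hs : Affine ε s) (M : GrC k) (c : k)
    (m : M.carrier) : act (regradeObj hs M) (algebraMap k (RingC k) c) m =
      act M (algebraMap k (RingC k) c) m :=
  regradeAction_algebraMap hs M c m

/-- The functor `M ↦ regradeObj hs M`, which keeps the underlying maps of homomorphisms. -/
def regradeFunctor {ε : ℤˣ} {s : ℤ ≃ ℤ} (hs : Affine ε s) : GrC k ⥤ GrC k where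
  obj M := regradeObj hs M
  map {M N} f := {
    toLin := { f.toLin.toAddMonoidHom with
      map_smul' := map_smul_of_generators (M := regradeObj hs M) (N := regradeObj hs N)
        f.toLin.toAddMonoidHom
        (fun c m => (congrArg f.toLin (act_regradeObj_algebraMap hs M c m)).trans
          ((f.toLin.map_smul _ _).trans (act_regradeObj_algebraMap hs N c (f.toLin m)).symm))
        (fun n m => (congrArg f.toLin (act_regradeObj_x hs M n m)).trans
          ((map_signedX f ε (s n) m).trans (act_regradeObj_x hs N n (f.toLin m)).symm)) }
    map_mem := fun i m hm => f.map_mem (mapFin s i) m hm }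

theorem act_regradeObj_regradeObj_x {ε : ℤˣ} {s : ℤ ≃ ℤ} (hs : Affine ε s) (M : GrC k) (n : ℤ)
    (m : M.carrier) :
    act (regradeObj hs.symm (regradeObj hs M)) (x k n) m = act M (x k n) m := by
  refine (act_regradeObj_x hs.symm (regradeObj hs M) n m).trans ?_
  have : signedX ε (regradeObj hs M) (s.symm n) = DistribSMul.toAddMonoidHom M.carrier (x k n) := by
    refine addHom_ext (M := regradeObj hs M) fun K m hm => ?_
    have h0 : signedX ε (regradeObj hs M) (s.symm n) m =
      sgn ε (s.symm n) K • act (regradeObj hs M) (x k (s.symm n)) m := signedX_apply hm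
    have hm' : (m : M.carrier) ∈ M.gr (mapFin s K) := hm
    have h1 : signedX ε M (s (s.symm n)) m = sgn ε (s (s.symm n)) (mapFin s K) •
      act M (x k (s (s.symm n))) m := signedX_apply hm'
    have h2 : sgn ε (s (s.symm n)) (mapFin s K) = sgn ε (s.symm n) K := by
      unfold sgn
      simp only [mem_mapFin]
    rw [h2, s.apply_symm_apply] at h1
    have hA : act (regradeObj hs M) (x k (s.symm n)) m = signedX ε M n m :=
      (act_regradeObj_x hs M (s.symm n) m).trans (by rw [s.apply_symm_apply])
    have h3 : sgn ε (s.symm n) K • sgn ε (s.symm n) K • act M (x k n) m = act M (x k n) m := by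
      rw [← mul_smul, sgn_mul_sgn, one_smul]
    exact (h0.trans (congrArg (sgn ε (s.symm n) K • ·) (hA.trans h1))).trans h3
  exact DFunLike.congr_fun this m

/-- Regrading along `s` and then along its inverse gives back the original module. -/
def regradeIso {ε : ℤˣ} {s : ℤ ≃ ℤ} (hs : Affine ε s) (M : GrC k) :
    M ≅ regradeObj hs.symm (regradeObj hs M) :=
  GrMod.isoMk (N := regradeObj hs.symm (regradeObj hs M))
    { AddEquiv.refl M.carrier with
      map_smul' := map_smul_of_generators (M := M) (N := regradeObj hs.symm (regradeObj hs M))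
        (AddMonoidHom.id M.carrier)
        (fun c m => ((act_regradeObj_algebraMap hs.symm (regradeObj hs M) c m).trans
          (act_regradeObj_algebraMap hs M c m)).symm)
        (fun n m => (act_regradeObj_regradeObj_x hs M n m).symm) }
    fun i m => by
      change m ∈ M.gr i ↔ m ∈ M.gr (mapFin s (mapFin s.symm i))
      rw [mapFin_mapFin_symm]

/-- Regrading as an autoequivalence. -/
def regrade {ε : ℤˣ} {s : ℤ ≃ ℤ} (hs : Affine ε s) : LinAutoEquiv k (GrC k) where
  toEquiv := CategoryTheory.Equivalence.mk (regradeFunctor hs) (regradeFunctor hs.symm)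
    (NatIso.ofComponents (fun M => regradeIso hs M) fun _ => rfl)
    (NatIso.ofComponents (fun M => (regradeIso hs.symm M).symm) fun _ => hom_ext fun _ => rfl)
  additive := ⟨fun {_ _ _ _} => rfl⟩
  linear := ⟨fun {_ N} f c => hom_ext fun m =>
    (act_regradeObj_algebraMap hs N c (f.toLin m)).symm⟩

/-- On the regraded module `x_0²` acts as `ε x_{s 0}² = ε (z - s 0)`, so that `z` acts on the
original one as `ε z + s 0` acts on the regraded one. -/
theorem alphaFun_regrade [CharZero k] {ε : ℤˣ} {s : ℤ ≃ ℤ} (hs : Affine ε s) :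
    alphaFun (regrade hs) (z k) = algebraMap k (degZero k) ((ε : ℤ) : k) *
      (z k - algebraMap k (degZero k) ((-(ε * s 0) : ℤ) : k)) := by
  refine alphaFun_eq_of_app fun N => hom_ext fun (m : N.carrier) => ?_
  have h1 : ((algebraMap k (degZero k) ((ε : ℤ) : k) *
      (z k - algebraMap k (degZero k) ((-(ε * s 0) : ℤ) : k)) : degZero k) : RingC k) =
      ((ε : ℤ) : RingC k) * (x k 0 ^ 2 + ((ε * s 0 : ℤ) : RingC k)) := by
    rw [map_intCast, map_intCast]
    push_cast
    rw [sub_neg_eq_add]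
    rfl
  have h2 : regradeAction hs N (x k 0 ^ 2) m = (ε : ℤ) • (x k 0 ^ 2 • m - s 0 • m) := by
    rw [← x_sq_smul, ← signedX_signedX, ← regradeAction_x hs, ← regradeAction_x hs, sq, map_mul]
    rfl
  have h3 : ∀ (a : ℤ) (b : RingC k), regradeAction hs N ((a : RingC k) * b) m =
      a • regradeAction hs N b m := fun a b => by
    rw [← zsmul_eq_mul, map_zsmul]
    rfl
  have h4 : ∀ (a : ℤ), regradeAction hs N (a : RingC k) m = a • m := fun a => by
    have := h3 a 1
    rwa [mul_one, map_one] at this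
  change x k 0 ^ 2 • m = regradeAction hs N _ m
  have h5 : regradeAction hs N (x k 0 ^ 2 + ((ε * s 0 : ℤ) : RingC k)) m =
      (ε : ℤ) • (x k 0 ^ 2 • m - s 0 • m) + (ε * s 0 : ℤ) • m := by
    rw [map_add, ← h2, ← h4]
    rfl
  rw [h1, h3, h5, mul_smul, ← smul_add, ← mul_smul,
    ← Units.val_mul, Int.units_mul_self, Units.val_one, one_smul, sub_add_cancel]

end RingC

/-! ### The isometry attached to an autoequivalence -/

namespace RingC

open GrMod Polynomial

variable {k : Type u} [Field k]

/-- An automorphism of a polynomial ring in one variable is an affine substitution. -/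
theorem exists_linear_of_algEquiv (g : k[X] ≃ₐ[k] k[X]) :
    ∃ a b : k, a ≠ 0 ∧ g X = C a * X + C b := by
  have h : ((g.symm X).comp (g X)).natDegree = 1 := by
    have : (g.symm X).comp (g X) = X := by
      rw [comp_eq_aeval, ← AlgEquiv.coe_toAlgHom, aeval_algHom_apply, aeval_X_left_apply]
      exact g.apply_symm_apply X
    rw [this, natDegree_X]
  rw [natDegree_comp] at h
  have h1 : (g X).natDegree = 1 := Nat.eq_one_of_mul_eq_one_left h
  refine ⟨(g X).coeff 1, (g X).coeff 0, fun h0 => ?_, eq_X_add_C_of_natDegree_le_one h1.le⟩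
  have := leadingCoeff_eq_zero.1 (by rwa [leadingCoeff, h1] : (g X).leadingCoeff = 0)
  rw [this, natDegree_zero] at h1
  exact zero_ne_one h1

variable [CharZero k]

theorem exists_alphaFun_z_linear (F : LinAutoEquiv k (GrC k)) :
    ∃ a b : k, a ≠ 0 ∧ alphaFun F (z k) = polyEquiv k (C a * X + C b) := by
  obtain ⟨a, b, ha, h⟩ :=
    exists_linear_of_algEquiv (((polyEquiv k).trans (alphaEquiv F)).trans (polyEquiv k).symm)
  refine ⟨a, b, ha, ?_⟩
  rw [← h]
  change _ = polyEquiv k ((polyEquiv k).symm (alphaFun F (polyEquiv k X)))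
  rw [AlgEquiv.apply_symm_apply, polyEquiv_X]

/-- If `F` acts on `C_φ` by `z ↦ a z + b`, it moves modules at the point `c` to the point
`(c - b) / a`. -/
theorem AtPoint.obj {F : LinAutoEquiv k (GrC k)} {a b : k} (ha : a ≠ 0)
    (hF : alphaFun F (z k) = polyEquiv k (C a * X + C b)) {c : k} {M : GrC k} (hM : AtPoint c M) :
    AtPoint ((c - b) / a) (F.obj M) := by
  have hlin := F.additive
  intro m
  have h1 : alphaHom F (polyEquiv k (X - C c)) =
      polyEquiv k (C a * (X - C ((c - b) / a))) := by
    have hC : polyEquiv k (C c) = algebraMap k (degZero k) c := (polyEquiv k).commutes c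
    rw [map_sub, map_sub, polyEquiv_X, hC, AlgHom.commutes, ← hC]
    change alphaFun F (z k) - _ = _
    rw [hF, ← map_sub]
    congr 1
    rw [mul_sub, ← C_mul, mul_div_cancel₀ _ ha, C_sub]
    ring
  have h2 : (mu (grading k) (polyEquiv k (X - C c))).app M = 0 := by
    have := poly_smul_eq_comp_mu (X - C c) (𝟙 M)
    rw [Category.id_comp] at this
    rw [← this, atPoint_iff_poly_smul.1 hM]
  have h3 := map_mu_app F (polyEquiv k (X - C c)) M
  have h3' : alphaFun F (polyEquiv k (X - C c)) = _ := h1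
  rw [h2, Functor.map_zero, h3'] at h3
  have h4 : ofPoly k (C a * (X - C ((c - b) / a))) • m = 0 := by
    rw [← coe_polyEquiv]
    exact (congrArg (fun t : F.obj M ⟶ F.obj M => t.toLin m) h3).symm
  have h5 : ofPoly k (C a) = algebraMap k (RingC k) a := aeval_C _ _
  by_contra h
  refine ha (algebraMap_smul_eq_zero ?_ h)
  rw [← h5, ← mul_smul, ← map_mul, h4]

omit [CharZero k] in
/-- Autoequivalences preserve simple modules. -/
theorem simple_obj_of (F : LinAutoEquiv k (GrC k)) (M : GrC k) [Simple M] : Simple (F.obj M) :=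
  simple_obj F.toEquiv.functor M

theorem isEmpty_obj_modX_iso_obj_modY (F : LinAutoEquiv k (GrC k)) (n : ℤ) :
    IsEmpty (F.obj (modX k n) ≅ F.obj (modY k n)) :=
  ⟨fun e => (isEmpty_modX_iso_modY n).false (F.toEquiv.functor.preimageIso e)⟩

/-- Points with two simple modules are moved to points with two simple modules. These are the
integral points. -/
theorem div_mem_range_intCast {F : LinAutoEquiv k (GrC k)} {a b : k} (ha : a ≠ 0)
    (hF : alphaFun F (z k) = polyEquiv k (C a * X + C b)) (n : ℤ) :
    ((n : k) - b) / a ∈ Set.range (Int.cast : ℤ → k) := by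
  by_contra h
  have hX := simple_obj_of F (modX k n)
  have hY := simple_obj_of F (modY k n)
  obtain ⟨e⟩ := nonempty_modO_iso h ((atPoint_modX n).obj ha hF)
  obtain ⟨f⟩ := nonempty_modO_iso h ((atPoint_modY n).obj ha hF)
  exact (isEmpty_obj_modX_iso_obj_modY F n).false (e.symm ≪≫ f)

variable (k) in
/-- The element `ε (z - d)` of `C_φ`. -/
def affZ (ε : ℤˣ) (d : ℤ) : degZero k :=
  algebraMap k (degZero k) ((ε : ℤ) : k) * (z k - algebraMap k (degZero k) (d : k))

omit [CharZero k] in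
theorem units_cast_mul_self (ε : ℤˣ) : ((ε : ℤ) : k) * ((ε : ℤ) : k) = 1 := by
  rw [← Int.cast_mul, ← Units.val_mul, Int.units_mul_self, Units.val_one, Int.cast_one]

theorem affZ_eq (ε : ℤˣ) (d : ℤ) :
    affZ k ε d = polyEquiv k (C ((ε : ℤ) : k) * X + C (-(((ε : ℤ) : k) * d))) := by
  have hC : ∀ c : k, polyEquiv k (C c) = algebraMap k (degZero k) c := (polyEquiv k).commutes
  rw [map_add, map_mul, hC, hC, polyEquiv_X, map_neg, map_mul, affZ]
  ring

theorem affZ_injective {ε ε' : ℤˣ} {d d' : ℤ} (h : affZ k ε d = affZ k ε' d') :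
    ε = ε' ∧ d = d' := by
  rw [affZ_eq, affZ_eq] at h
  have h1 := (polyEquiv k).injective h
  have h2 := congrArg (fun p : k[X] => p.coeff 1) h1
  have h3 := congrArg (fun p : k[X] => p.coeff 0) h1
  simp only [coeff_add, coeff_C_mul, coeff_X_one, coeff_X_zero, mul_one, mul_zero, coeff_C_zero,
    add_zero, zero_add, coeff_C_of_ne_zero one_ne_zero] at h2 h3
  have h4 : ε = ε' := Units.ext (Int.cast_injective h2)
  subst h4
  refine ⟨rfl, ?_⟩
  have h5 : ((ε : ℤ) : k) ≠ 0 := left_ne_zero_of_mul_eq_one (units_cast_mul_self ε)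
  exact Int.cast_injective (mul_left_cancel₀ h5 (neg_injective h3))

/-- An autoequivalence acts on `C_φ` by `z ↦ ε (z - d)` for a sign `ε` and an integer `d`. -/
theorem exists_alphaFun_z_eq (F : LinAutoEquiv k (GrC k)) :
    ∃ (ε : ℤˣ) (d : ℤ), alphaFun F (z k) = affZ k ε d := by
  obtain ⟨a, b, ha, hF⟩ := exists_alphaFun_z_linear F
  obtain ⟨a', b', ha', hF'⟩ := exists_alphaFun_z_linear F.symm
  have haa : a' * a = 1 := by
    have h1 : alphaFun F (alphaFun F.symm (z k)) = z k := (alphaEquiv F).apply_symm_apply (z k)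
    rw [hF'] at h1
    have hC : ∀ c : k, polyEquiv k (C c) = algebraMap k (degZero k) c := (polyEquiv k).commutes
    have h2 : alphaHom F (polyEquiv k (C a' * X + C b')) =
        polyEquiv k (C a' * (C a * X + C b) + C b') := by
      rw [map_add, map_mul, map_add, map_mul, hC, hC, AlgHom.commutes, AlgHom.commutes,
        polyEquiv_X, map_add _ (C a' * _), map_mul, hC, hC, ← hF]
      rfl
    have h3 := (polyEquiv k).injective (h2.symm.trans (h1.trans (polyEquiv_X k).symm))
    have h4 := congrArg (fun p : k[X] => p.coeff 1) h3
    simpa using h4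
  -- for each autoequivalence the inverse of the multiplier is an integer, the difference of the
  -- images of the points `1` and `0`; the multiplier belongs to the inverse autoequivalence
  have hint : ∀ {F : LinAutoEquiv k (GrC k)} {a b : k}, a ≠ 0 →
      alphaFun F (z k) = polyEquiv k (C a * X + C b) →
        ∃ r d : ℤ, (r : k) * a = 1 ∧ b = -(a * d) := by
    intro F a b ha hF
    obtain ⟨d, hd⟩ := div_mem_range_intCast ha hF 0
    obtain ⟨e, he⟩ := div_mem_range_intCast ha hF 1
    refine ⟨e - d, d, ?_, ?_⟩
    · push_cast
      rw [he, hd, ← sub_div, div_mul_cancel₀ _ ha]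
      push_cast
      ring
    · rw [hd, mul_div_cancel₀ _ ha]
      push_cast
      ring
  obtain ⟨r, d, hr, hb⟩ := hint ha hF
  obtain ⟨r', -, hr', -⟩ := hint ha' hF'
  have hra : (r' : k) = a := by
    rw [← mul_one (r' : k), ← haa, ← mul_assoc, hr', one_mul]
  have hrr : r' * r = 1 := by
    have : ((r' * r : ℤ) : k) = ((1 : ℤ) : k) := by
      push_cast
      rw [hra, mul_comm, hr]
    exact Int.cast_injective this
  let ε : ℤˣ := ⟨r', r, hrr, by rw [mul_comm, hrr]⟩
  refine ⟨ε, d, ?_⟩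
  rw [hF, affZ_eq, hb, ← hra]

theorem AtPoint.obj_of_affZ {F : LinAutoEquiv k (GrC k)} {ε : ℤˣ} {d : ℤ}
    (hF : alphaFun F (z k) = affZ k ε d) {c : k} {M : GrC k} (hM : AtPoint c M) :
    AtPoint (((ε : ℤ) : k) * c + (d : k)) (F.obj M) := by
  rw [affZ_eq] at hF
  have h5 : ((ε : ℤ) : k) ≠ 0 := left_ne_zero_of_mul_eq_one (units_cast_mul_self ε)
  have := hM.obj h5 hF
  convert this using 1
  rw [eq_div_iff h5, add_mul, mul_right_comm, units_cast_mul_self]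
  ring

/-- The effect of an autoequivalence on the simple modules `X_n` and `Y_n`. -/
theorem nonempty_biprod_iso {F : LinAutoEquiv k (GrC k)} {ε : ℤˣ} {d : ℤ}
    (hF : alphaFun F (z k) = affZ k ε d) (n : ℤ) :
    Nonempty ((F.obj (modX k n) ⊞ F.obj (modY k n)) ≅
      (modX k (ε * n + d) ⊞ modY k (ε * n + d))) := by
  have hX := simple_obj_of F (modX k n)
  have hY := simple_obj_of F (modY k n)
  have hcast : ((ε : ℤ) : k) * (n : k) + (d : k) = ((ε * n + d : ℤ) : k) := by push_cast; rfl
  have hX' := (atPoint_modX (k := k) n).obj_of_affZ hF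
  have hY' := (atPoint_modY (k := k) n).obj_of_affZ hF
  rw [hcast] at hX' hY'
  have hne := isEmpty_obj_modX_iso_obj_modY F n
  rcases nonempty_modX_or_modY_iso hX' with ⟨⟨e⟩⟩ | ⟨⟨e⟩⟩ <;>
    rcases nonempty_modX_or_modY_iso hY' with ⟨⟨f⟩⟩ | ⟨⟨f⟩⟩
  · exact (hne.false (e.symm ≪≫ f)).elim
  · exact ⟨(biprod.mapIso e f).symm⟩
  · exact ⟨(biprod.mapIso e f).symm ≪≫ biprod.braiding _ _⟩
  · exact (hne.false (e.symm ≪≫ f)).elim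

theorem nonempty_obj_modO_iso {F : LinAutoEquiv k (GrC k)} {ε : ℤˣ} {d : ℤ}
    (hF : alphaFun F (z k) = affZ k ε d) {c : k} (hc : c ∉ Set.range (Int.cast : ℤ → k)) :
    Nonempty (F.obj (modO k c) ≅ modO k (((ε : ℤ) : k) * c + (d : k))) := by
  have hS : Simple (modO k c) := (isTransitive_modO hc).simple
  have hFS := simple_obj_of F (modO k c)
  obtain ⟨e⟩ := nonempty_modO_iso (fun ⟨m, hm⟩ => hc ⟨ε * (m - d), by
    push_cast
    rw [hm, add_sub_cancel_right, ← mul_assoc, units_cast_mul_self, one_mul]⟩)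
    ((atPoint_modO c).obj_of_affZ hF)
  exact ⟨e.symm⟩

/-- Isomorphic direct sums `X_m ⊕ Y_m` have the same index. -/
theorem eq_of_biprod_iso {m n : ℤ} (e : (modX k m ⊞ modY k m) ≅ (modX k n ⊞ modY k n)) : m = n := by
  have h1 : AtPoint (n : k) (modX k m) :=
    ((atPoint_modX n).biprod (atPoint_modY n)).of_mono (biprod.inl ≫ e.hom)
  obtain ⟨v, hv⟩ := (isTransitive_modX (k := k) m).1
  exact Int.cast_injective ((atPoint_modX (k := k) m).eq h1 hv)

/-- The isometry `n ↦ ε n + d` of `ℤ`. -/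
def affIsom (ε : ℤˣ) (d : ℤ) : ℤ ≃ᵢ ℤ where
  toFun n := ε * n + d
  invFun n := ε * (n - d)
  left_inv n := by
    change (ε : ℤ) * (ε * n + d - d) = n
    rw [add_sub_cancel_right, ← mul_assoc, ← Units.val_mul, Int.units_mul_self, Units.val_one,
      one_mul]
  right_inv n := by
    change (ε : ℤ) * (ε * (n - d)) + d = n
    rw [← mul_assoc, ← Units.val_mul, Int.units_mul_self, Units.val_one, one_mul, sub_add_cancel]
  isometry_toFun := Isometry.of_dist_eq fun m n => by
    rw [Int.dist_eq, Int.dist_eq]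
    rcases Int.units_eq_one_or ε with rfl | rfl
    · simp
    · push_cast
      rw [← abs_neg]
      congr 1
      ring

@[simp] theorem affIsom_apply (ε : ℤˣ) (d n : ℤ) : affIsom ε d n = ε * n + d := rfl

theorem affIsom_eq_iff {ε ε' : ℤˣ} {d d' : ℤ} :
    (∀ n : ℤ, affIsom ε d n = ε' * n + d') ↔ ε = ε' ∧ d = d' := by
  refine ⟨fun h => ?_, ?_⟩
  · have h0 := h 0
    have h1 := h 1
    simp only [affIsom_apply, mul_zero, zero_add, mul_one] at h0 h1
    subst h0
    exact ⟨Units.ext (by simpa using h1), rfl⟩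
  · rintro ⟨rfl, rfl⟩ n
    rfl

/-- Every isometry of `ℤ` has the form `n ↦ ε n + d`. -/
theorem exists_eq_affIsom (g : ℤ ≃ᵢ ℤ) : ∃ (ε : ℤˣ) (d : ℤ), g = affIsom ε d := by
  have hg : ∀ m n : ℤ, |g m - g n| = |m - n| := fun m n => by
    have := g.dist_eq m n
    rw [Int.dist_eq, Int.dist_eq] at this
    exact_mod_cast this
  have h1 : g 1 - g 0 = 1 ∨ g 1 - g 0 = -1 := by
    have := hg 1 0
    rwa [sub_zero, abs_one, abs_eq zero_le_one] at this
  rcases h1 with h1 | h1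
  · refine ⟨1, g 0, IsometryEquiv.ext fun n => ?_⟩
    have h2 := hg n 0
    have h3 := hg n 1
    rw [affIsom_apply, Units.val_one]
    grind
  · refine ⟨-1, g 0, IsometryEquiv.ext fun n => ?_⟩
    have h2 := hg n 0
    have h3 := hg n 1
    rw [affIsom_apply, Units.val_neg, Units.val_one]
    grind

theorem exists_alpha_z_eq (P : Pic k) : ∃ (ε : ℤˣ) (d : ℤ), alpha k P (z k) = affZ k ε d := by
  obtain ⟨F, rfl⟩ : ∃ F, PicardGroup.mk F = P := Quotient.exists_rep P
  exact exists_alphaFun_z_eq F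

omit [CharZero k] in
theorem algEquiv_apply_affZ {g : degZero k ≃ₐ[k] degZero k} {ε ε' : ℤˣ} {d d' : ℤ}
    (hg : g (z k) = affZ k ε d) : g (affZ k ε' d') = affZ k (ε * ε') (ε * d' + d) := by
  have h := units_cast_mul_self (k := k) ε
  have h' : algebraMap k (degZero k) ((ε : ℤ) : k) *
      algebraMap k (degZero k) ((ε : ℤ) : k) = 1 := by
    rw [← map_mul, h, map_one]
  have h1 : (((ε * ε' : ℤˣ) : ℤ) : k) = ((ε : ℤ) : k) * ((ε' : ℤ) : k) := by
    rw [Units.val_mul, Int.cast_mul]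
  have h2 : ((ε * d' + d : ℤ) : k) = ((ε : ℤ) : k) * (d' : k) + (d : k) := by
    rw [Int.cast_add, Int.cast_mul]
  rw [affZ, map_mul, map_sub, AlgEquiv.commutes, AlgEquiv.commutes, hg, affZ, affZ, h1, h2,
    map_mul, map_add, map_mul]
  linear_combination (algebraMap k (degZero k) ((ε' : ℤ) : k) *
    algebraMap k (degZero k) (d' : k)) * h'

variable (k) in
/-- The homomorphism from the Picard group to the isometry group of `ℤ`: the class which acts on
`C_φ` by `z ↦ ε (z - d)` is sent to `n ↦ ε n + d`. -/
def isomHom : Pic k →* (ℤ ≃ᵢ ℤ) :=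
  MonoidHom.mk' (fun P => affIsom (exists_alpha_z_eq P).choose
      (exists_alpha_z_eq P).choose_spec.choose) (by
    intro P Q
    have hP := (exists_alpha_z_eq P).choose_spec.choose_spec
    have hQ := (exists_alpha_z_eq Q).choose_spec.choose_spec
    have hPQ := (exists_alpha_z_eq (P * Q)).choose_spec.choose_spec
    have h := algEquiv_apply_affZ hP (ε' := (exists_alpha_z_eq Q).choose)
      (d' := (exists_alpha_z_eq Q).choose_spec.choose)
    rw [← hQ, ← AlgEquiv.mul_apply, ← map_mul] at h
    obtain ⟨h1, h2⟩ := affZ_injective (h.symm.trans hPQ)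
    refine IsometryEquiv.ext fun n => ?_
    rw [IsometryEquiv.mul_apply, affIsom_apply, affIsom_apply, affIsom_apply, ← h2, ← h1]
    push_cast
    ring)

theorem isomHom_iff (P : Pic k) (ε : ℤˣ) (d : ℤ) :
    (∀ n : ℤ, isomHom k P n = ε * n + d) ↔ alpha k P (z k) = affZ k ε d := by
  have hP := (exists_alpha_z_eq P).choose_spec.choose_spec
  refine affIsom_eq_iff.trans ⟨?_, fun h => affZ_injective (hP.symm.trans h)⟩
  rintro ⟨rfl, rfl⟩
  exact hP

theorem alpha_eq_one_of_isomHom_eq_one {P : Pic k} (h : isomHom k P = 1) : alpha k P = 1 := by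
  have h1 : alpha k P (z k) = affZ k 1 0 := (isomHom_iff P 1 0).1 fun n => by
    rw [h]
    simp
  have h2 : alpha k P (z k) = z k := by
    rw [h1, affZ]
    simp
  have h3 : ((alpha k P : degZero k →ₐ[k] degZero k).comp (polyEquiv k : k[X] →ₐ[k] degZero k)) =
      (polyEquiv k : k[X] →ₐ[k] degZero k) := by
    refine Polynomial.algHom_ext ?_
    change alpha k P (polyEquiv k X) = polyEquiv k X
    rw [polyEquiv_X, h2]
  refine AlgEquiv.ext fun a => ?_
  obtain ⟨p, rfl⟩ := (polyEquiv k).surjective a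
  exact DFunLike.congr_fun h3 p

theorem isomHom_surjective : Function.Surjective (isomHom k) := by
  intro g
  obtain ⟨ε, d, rfl⟩ := exists_eq_affIsom g
  have hs : Affine ε (affIsom ε d).symm.toEquiv := ⟨fun n => by
    change (ε : ℤ) * (n - d) = ε * n + ε * (0 - d)
    ring⟩
  refine ⟨PicardGroup.mk (regrade hs), IsometryEquiv.ext fun n => ?_⟩
  refine (isomHom_iff _ ε d).2 ?_ n
  rw [alpha_mk, alphaFun_regrade, affZ]
  have : -((ε : ℤ) * (affIsom ε d).symm.toEquiv 0) = d := by
    change -((ε : ℤ) * (ε * (0 - d))) = d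
    rw [← mul_assoc, ← Units.val_mul, Int.units_mul_self]
    simp
  rw [this]

end RingC

end

theorem mainTheorem3 (k : Type u) [Field k] [CharZero k] :
    ∃ (ι : Multiplicative ZFin →* RingC.Pic k) (π : RingC.Pic k →* (ℤ ≃ᵢ ℤ))
      (α : RingC.Pic k →* (RingC.degZero k ≃ₐ[k] RingC.degZero k)),
      -- the sequence `1 → ℤ_fin → Pic → Iso(ℤ) → 1` is exact
      (Function.Injective ι ∧ ι.range = π.ker ∧ Function.Surjective π) ∧
      -- the first map sends `J` to the class of the twist functor `(J)`
      (∀ J : Finset ℤ,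
        ι (Multiplicative.ofAdd (ZFin.of J)) = PicardGroup.mk (RingC.twist k J)) ∧
      -- the second map sends `[F]` to an isometry of the form `n ↦ ε n + d`
      (∀ F : LinAutoEquiv k (RingC.GrC k), ∃ (ε : ℤˣ) (d : ℤ), ∀ n : ℤ,
        π (PicardGroup.mk F) n = ε * n + d) ∧
      -- which is the one determined by `F X_n ⊕ F Y_n ≅ X_{ε n + d} ⊕ Y_{ε n + d}`
      (∀ (F : LinAutoEquiv k (RingC.GrC k)) (ε : ℤˣ) (d : ℤ),
        (∀ n : ℤ, π (PicardGroup.mk F) n = ε * n + d) ↔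
          ∀ n : ℤ, Nonempty ((F.obj (RingC.modX k n) ⊞ F.obj (RingC.modY k n)) ≅
            (RingC.modX k (ε * n + d) ⊞ RingC.modY k (ε * n + d)))) ∧
      -- and which satisfies `F 𝒪_c ≅ 𝒪_{ε c + d}` for `c ∈ k ∖ ℤ`
      (∀ (F : LinAutoEquiv k (RingC.GrC k)) (ε : ℤˣ) (d : ℤ),
        (∀ n : ℤ, π (PicardGroup.mk F) n = ε * n + d) →
          ∀ c : k, c ∉ Set.range (Int.cast : ℤ → k) →
            Nonempty (F.obj (RingC.modO k c) ≅ RingC.modO k (((ε : ℤ) : k) * c + (d : k)))) ∧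
      -- `C_φ` is the polynomial ring `k[z]`, and `μ : C_φ → End(id)` is bijective
      Function.Bijective (Polynomial.aeval (R := k) (RingC.z k)) ∧
      Function.Bijective (GrMod.mu (RingC.grading k)) ∧
      -- `α [F]` is the automorphism of `C_φ` induced by `F` through `C_φ = End(id)`
      (∀ (F : LinAutoEquiv k (RingC.GrC k)) (a : RingC.degZero k),
        GrMod.mu (RingC.grading k) (α (PicardGroup.mk F) a) =
          F.conj (GrMod.mu (RingC.grading k) a)) ∧
      -- the second map is equivalently given by `α`
      (∀ (F : LinAutoEquiv k (RingC.GrC k)) (ε : ℤˣ) (d : ℤ),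
        (∀ n : ℤ, π (PicardGroup.mk F) n = ε * n + d) ↔
          α (PicardGroup.mk F) (RingC.z k) =
            algebraMap k (RingC.degZero k) ((ε : ℤ) : k) *
              (RingC.z k - algebraMap k (RingC.degZero k) (d : k))) := by
  have hiff := fun (F : LinAutoEquiv k (RingC.GrC k)) => RingC.isomHom_iff (PicardGroup.mk F)
  refine ⟨RingC.twistHom k, RingC.isomHom k, RingC.alpha k,
    ⟨RingC.twistHom_injective, ?_, RingC.isomHom_surjective⟩, fun J => rfl, fun F => ?_,
    fun F ε d => ⟨fun h n => ?_, fun h n => ?_⟩, fun F ε d h c hc => ?_,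
    RingC.aeval_z_bijective k, RingC.mu_bijective, fun F a => RingC.mu_alphaFun F a,
    fun F ε d => hiff F ε d⟩
  · ext P
    constructor
    · rintro ⟨J, rfl⟩
      refine IsometryEquiv.ext fun n => ?_
      have h := (RingC.isomHom_iff (RingC.twistHom k J) 1 0).2 (by
        rw [RingC.alpha_twistHom, RingC.affZ]
        simp) n
      simpa using h
    · intro hP
      exact RingC.exists_twist_of_alpha_eq_one (RingC.alpha_eq_one_of_isomHom_eq_one hP)
  · obtain ⟨ε, d, h⟩ := RingC.exists_alphaFun_z_eq F
    exact ⟨ε, d, (hiff F ε d).2 h⟩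
  · exact RingC.nonempty_biprod_iso ((hiff F ε d).1 h) n
  · obtain ⟨ε', d', h'⟩ := RingC.exists_alphaFun_z_eq F
    obtain ⟨e⟩ := RingC.nonempty_biprod_iso h' n
    obtain ⟨f⟩ := h n
    rw [(hiff F ε' d').2 h' n]
    exact RingC.eq_of_biprod_iso (e.symm ≪≫ f)
  · exact RingC.nonempty_obj_modO_iso ((hiff F ε d).1 h) hc
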